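/- Let $n\ge 2$ and $0\le i\le n-2$. Let $\Delta\subseteq\mathbb{R}^n$ be a finite simplicial complex whose underlying space $|\Delta|$ is connected, and suppose that $\Delta$ is pure (every maximal face has dimension $n$) and hereditary (any two $n$-faces $\sigma,\sigma'$ meeting in a nonempty face $\beta$ are joined by a sequence $\sigma=\sigma_0,\dots,\sigma_m=\sigma'$ of $n$-faces containing $\beta$ such that each $\sigma_{k-1}\cap\sigma_k$ is an interior $(n-1)$-face). Write $\Delta_j$ for the set of $j$-faces and $\Delta_j^\circ$ for the set of interior $j$-faces, where a face is a boundary face if it is contained in an $(n-1)$-face that lies in exactly one $n$-face, and is interior otherwise (so $\Delta_n^\circ=\Delta_n$). Let $r_\tau\ge 0$ $(\tau\in\Delta_{n-1}^\circ)$ and $s_\beta\ge 0$ $(\beta\in\Delta_i)$ be integers with $r_\tau\le s_\beta$ for all $\tau\in\Delta_{n-1}^\circ$ and $\beta\in\Delta_i^\circ$. **Splines.** Let $\mathtt{S}=\mathbb{R}[x_0,\dots,x_n]$. For a face $\sigma$ of $\Delta$ let $\hat\sigma\subseteq\mathbb{R}^{n+1}$ be the convex hull of the origin and $\{1\}\times\sigma$,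 and let $\hat\Delta$ be the simplicial complex in $\mathbb{R}^{n+1}$ consisting of the simplices $\hat\sigma$ and all their faces. Let $\mathcal{S}^{\bm r,\bm s}(\hat\Delta)$ be the $\mathtt{S}$-module of all continuous functions $f\colon|\hat\Delta|\to\mathbb{R}$ such that $f|_{\hat\sigma}$ is a polynomial for each $\sigma\in\Delta_n$; for each $\tau\in\Delta_{n-1}^\circ$, $f$ is of class $C^{r_\tau}$ on the star of $\hat\tau$ (the union of the simplices of $\hat\Delta$ containing $\hat\tau$); and for each $\beta\in\Delta_i$, the polynomials $f|_{\hat\sigma}$, $\sigma\in\Delta_n$, $\sigma\supseteq\beta$, have the same partial derivatives of all orders at most $s_\beta$ at every point of $\hat\beta$. The ring $\mathtt{S}$ acts by pointwise multiplication. **Ideals.** For $\tau\in\Delta_{n-1}^\circ$ choose a nonzero linear form $\ell_\tau\in\mathtt{S}$ vanishing on $\hat\tau$. For $\beta\in\Delta_i$ let $\hat{\mathfrak m}_\beta\subseteq\mathtt{S}$ be the ideal generated by the homogenizations, with respect to $x_0$, of all polynomials in $\mathbb{R}[x_1,\dots,x_n]$ vanishing on $\beta$. Put $\mathtt{J}(\sigma)=0$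 for $\sigma\in\Delta_n$, $$\mathtt{J}(\tau)=\langle\ell_\tau^{r_\tau+1}\rangle\cap\bigcap_{\beta\in\Delta_i,\ \beta\subset\tau}\hat{\mathfrak m}_\beta^{\,s_\beta+1}\quad(\tau\in\Delta_{n-1}^\circ),\qquad \mathtt{J}(\gamma)=\sum_{\tau\in\Delta_{n-1}^\circ,\ \tau\supseteq\gamma}\mathtt{J}(\tau)\quad(\gamma\in\Delta_j^\circ,\ 0\le j\le n-2).$$ **Complexes.** Fix a total order of the vertices and orient every face by it. Let $\mathcal{R}$ be the simplicial chain complex of $\Delta$ relative to its boundary with coefficients in $\mathtt{S}$, so that $\mathcal{R}_j=\bigoplus_{\beta\in\Delta_j^\circ}\mathtt{S}[\beta]$, with differentials $\partial_j$. Let $\mathcal{J}\subseteq\mathcal{R}$ be the subcomplex with $\mathcal{J}_j=\bigoplus_{\beta\in\Delta_j^\circ}\mathtt{J}(\beta)[\beta]$, and let $\overline\partial_j$ be the differentials of the quotient complex $\mathcal{R}/\mathcal{J}$. **Claim.** There is an isomorphism of $\mathtt{S}$-modules $\mathcal{S}^{\bm r,\bm s}(\hat\Delta)\cong\ker(\overline\partial_n)$,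 where $\overline\partial_n\colon\bigoplus_{\sigma\in\Delta_n}\mathtt{S}[\sigma]\to\mathcal{R}_{n-1}/\mathcal{J}_{n-1}$ is the top differential of $\mathcal{R}/\mathcal{J}$. More precisely, for suitable orientation signs $\varepsilon_\sigma\in\{1,-1\}$ $(\sigma\in\Delta_n)$ the map $f\mapsto\sum_{\sigma\in\Delta_n}\varepsilon_\sigma\,f|_{\hat\sigma}\,[\sigma]$ is such an isomorphism. -/

import Mathlib

open Geometry

noncomputable section

namespace SuperSpline

/-! ### Simplicial complexes in real coordinate space -/

/-- Simplicial complexes embedded in `ℝᴺ`; a face is stored as the finite set of its vertices, so a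
`k`-dimensional face is a face with `k + 1` vertices, and the simplex itself is the convex hull. -/
abbrev Complex (N : ℕ) := SimplicialComplex ℝ (Fin N → ℝ)

/-- The set of `k`-dimensional faces. -/
def facesOfDim {N : ℕ} (K : Complex N) (k : ℕ) : Set (Finset (Fin N → ℝ)) :=
  {β | β ∈ K.faces ∧ β.card = k + 1}

/-- A face of `K ⊆ ℝᴺ` lies on the boundary if it is a face of some codimension one face that
belongs to exactly one `N`-dimensional face. -/
def IsBoundaryFace {N : ℕ} (K : Complex N) (β : Finset (Fin N → ℝ)) : Prop :=
  ∃ τ ∈ K.faces, τ.card = N ∧ β ⊆ τ ∧ ∃! σ, σ ∈ facesOfDim K N ∧ τ ⊆ σ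

/-- The set of interior `k`-dimensional faces (every `N`-dimensional face is interior). -/
def interiorFaces {N : ℕ} (K : Complex N) (k : ℕ) : Set (Finset (Fin N → ℝ)) :=
  {β | β ∈ facesOfDim K k ∧ ¬ IsBoundaryFace K β}

/-- All maximal faces have dimension `N`. -/
def IsPure {N : ℕ} (K : Complex N) : Prop :=
  ∀ σ ∈ K.facets, σ ∈ facesOfDim K N

/-- Any two `N`-faces that meet in a face `β` are joined by a sequence of `N`-faces containing `β`,
in which consecutive members meet in an interior codimension one face. -/
def IsHereditary {N : ℕ} (K : Complex N) : Prop :=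
  ∀ σ ∈ facesOfDim K N, ∀ σ' ∈ facesOfDim K N, ∀ β ∈ K.faces,
    (β : Set (Fin N → ℝ)) = (σ : Set (Fin N → ℝ)) ∩ σ' →
    ∃ (m : ℕ) (c : ℕ → Finset (Fin N → ℝ)), c 0 = σ ∧ c m = σ' ∧
      (∀ k ≤ m, c k ∈ facesOfDim K N ∧ β ⊆ c k) ∧
      ∀ k < m, ∃ τ ∈ interiorFaces K (N - 1),
        (τ : Set (Fin N → ℝ)) = (c k : Set (Fin N → ℝ)) ∩ c (k + 1)

/-- The underlying set of the star of `β`, the union of all simplices that have `β` as a face. -/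
def starSpace {N : ℕ} (K : Complex N) (β : Finset (Fin N → ℝ)) : Set (Fin N → ℝ) :=
  ⋃ σ ∈ K.faces, ⋃ _ : β ⊆ σ, convexHull ℝ (σ : Set (Fin N → ℝ))

/-! ### Splines with mixed smoothness and supersmoothness -/

/-- Real-valued functions on a subset `X` of `ℝᴺ`. -/
def FunOn {N : ℕ} (X : Set (Fin N → ℝ)) : Type := X → ℝ

instance {N : ℕ} (X : Set (Fin N → ℝ)) : AddCommGroup (FunOn X) :=
  inferInstanceAs (AddCommGroup (X → ℝ))

/-- A polynomial acts on a function by pointwise multiplication with its values. -/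
instance {N : ℕ} (X : Set (Fin N → ℝ)) : Module (MvPolynomial (Fin N) ℝ) (FunOn X) :=
  Module.compHom (X → ℝ) (RingHom.pi fun x : X => MvPolynomial.eval x.1)

/-- Extension by zero to all of `ℝᴺ`. -/
def extendZero {N : ℕ} {X : Set (Fin N → ℝ)} (f : FunOn X) : (Fin N → ℝ) → ℝ :=
  Function.extend (Subtype.val : X → Fin N → ℝ) f 0

/-- `f` is given on each `N`-dimensional simplex `σ` by the polynomial `P σ` of degree at most
`d`. -/
def HasPieces {N : ℕ} (K : Complex N) (d : ℕ)
    (P : Finset (Fin N → ℝ) → MvPolynomial (Fin N) ℝ) (f : FunOn K.space) : Prop :=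
  ∀ σ ∈ facesOfDim K N, (P σ).totalDegree ≤ d ∧
    ∀ x : K.space, x.1 ∈ convexHull ℝ (σ : Set (Fin N → ℝ)) → f x = MvPolynomial.eval x.1 (P σ)

/-- The partial derivative of a polynomial along a list of coordinate directions. -/
def iterPderiv {N : ℕ} (L : List (Fin N)) (p : MvPolynomial (Fin N) ℝ) :
    MvPolynomial (Fin N) ℝ :=
  L.foldl (fun q j => MvPolynomial.pderiv j q) p

/-- Supersmoothness `s` at the face `β` of the piecewise polynomial with pieces `P`: on `β`, the
pieces on all `N`-faces that contain `β` have the same partial derivatives up to order `s`. -/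
def SmoothAtFace {N : ℕ} (K : Complex N) (P : Finset (Fin N → ℝ) → MvPolynomial (Fin N) ℝ)
    (s : ℕ) (β : Finset (Fin N → ℝ)) : Prop :=
  ∀ σ ∈ facesOfDim K N, ∀ σ' ∈ facesOfDim K N, β ⊆ σ → β ⊆ σ' →
    ∀ L : List (Fin N), L.length ≤ s → ∀ x ∈ convexHull ℝ (β : Set (Fin N → ℝ)),
      MvPolynomial.eval x (iterPderiv L (P σ)) = MvPolynomial.eval x (iterPderiv L (P σ'))

/-- Superspline of degree at most `d`: a piecewise polynomial function that is continuous on `K`,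
of class `C^{r τ}` on the star of each interior codimension one face `τ`, and has supersmoothness
`s β` at each face `β` of the family `B`. -/
def IsSuperspline {N : ℕ} (K : Complex N) (r : Finset (Fin N → ℝ) → ℕ)
    (B : Set (Finset (Fin N → ℝ))) (s : Finset (Fin N → ℝ) → ℕ) (d : ℕ)
    (f : FunOn K.space) : Prop :=
  ∃ P : Finset (Fin N → ℝ) → MvPolynomial (Fin N) ℝ, HasPieces K d P f ∧
    ContinuousOn (extendZero f) K.space ∧
    (∀ τ ∈ interiorFaces K (N - 1), ContDiffOn ℝ (r τ) (extendZero f) (starSpace K τ)) ∧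
    ∀ β ∈ B, SmoothAtFace K P (s β) β

theorem extendZero_apply {N : ℕ} {X : Set (Fin N → ℝ)} (f : FunOn X) (x : X) :
    extendZero f x.1 = f x :=
  Subtype.val_injective.extend_apply _ _ _

theorem smul_apply {N : ℕ} {X : Set (Fin N → ℝ)} (p : MvPolynomial (Fin N) ℝ) (f : FunOn X)
    (x : X) : (p • f) x = MvPolynomial.eval x.1 p * f x := rfl

theorem add_apply {N : ℕ} {X : Set (Fin N → ℝ)} (f g : FunOn X) (x : X) :
    (f + g) x = f x + g x := rfl

theorem starSpace_subset {N : ℕ} (K : Complex N) (β : Finset (Fin N → ℝ)) :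
    starSpace K β ⊆ K.space := by
  intro x hx
  simp only [starSpace, Set.mem_iUnion] at hx
  obtain ⟨σ, hσ, -, hx⟩ := hx
  exact SimplicialComplex.convexHull_subset_space hσ hx

theorem extendZero_add {N : ℕ} {X : Set (Fin N → ℝ)} (f g : FunOn X) (x : Fin N → ℝ)
    (hx : x ∈ X) : extendZero (f + g) x = extendZero f x + extendZero g x := by
  have h1 := extendZero_apply (f + g) ⟨x, hx⟩
  have h2 := extendZero_apply f ⟨x, hx⟩
  have h3 := extendZero_apply g ⟨x, hx⟩
  simp only at h1 h2 h3
  rw [h1, h2, h3, add_apply]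

theorem extendZero_smul {N : ℕ} {X : Set (Fin N → ℝ)} (p : MvPolynomial (Fin N) ℝ)
    (f : FunOn X) (x : Fin N → ℝ) (hx : x ∈ X) :
    extendZero (p • f) x = MvPolynomial.eval x p * extendZero f x := by
  have h1 := extendZero_apply (p • f) ⟨x, hx⟩
  have h2 := extendZero_apply f ⟨x, hx⟩
  simp only at h1 h2
  rw [h1, h2, smul_apply]

theorem iterPderiv_add {N : ℕ} (L : List (Fin N)) (p q : MvPolynomial (Fin N) ℝ) :
    iterPderiv L (p + q) = iterPderiv L p + iterPderiv L q := by
  induction L generalizing p q with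
  | nil => rfl
  | cons j L ih => simpa [iterPderiv, map_add] using ih _ _

theorem iterPderiv_zero {N : ℕ} (L : List (Fin N)) :
    iterPderiv L (0 : MvPolynomial (Fin N) ℝ) = 0 := by
  have h := iterPderiv_add L 0 0
  simpa using h

theorem iterPderiv_mul_eq {N : ℕ} (x : Fin N → ℝ) (s : ℕ) :
    ∀ (p q q' : MvPolynomial (Fin N) ℝ),
      (∀ L : List (Fin N), L.length ≤ s →
        MvPolynomial.eval x (iterPderiv L q) = MvPolynomial.eval x (iterPderiv L q')) →
      ∀ L : List (Fin N), L.length ≤ s →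
        MvPolynomial.eval x (iterPderiv L (p * q)) =
          MvPolynomial.eval x (iterPderiv L (p * q')) := by
  induction s with
  | zero =>
    intro p q q' h L hL
    have h0 := h [] le_rfl
    obtain rfl : L = [] := List.eq_nil_of_length_eq_zero (by omega)
    simp only [iterPderiv, List.foldl_nil, map_mul] at h0 ⊢
    rw [h0]
  | succ s ih =>
    intro p q q' h L hL
    cases L with
    | nil =>
      have h0 := h [] (by simp)
      simp only [iterPderiv, List.foldl_nil, map_mul] at h0 ⊢
      rw [h0]
    | cons j L =>
      have hL' : L.length ≤ s := by simpa using hL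
      have e : ∀ u : MvPolynomial (Fin N) ℝ, iterPderiv (j :: L) u =
          iterPderiv L (MvPolynomial.pderiv j u) := fun u => rfl
      rw [e, e, Derivation.leibniz, Derivation.leibniz, iterPderiv_add, iterPderiv_add, map_add,
        map_add]
      simp only [smul_eq_mul]
      rw [ih p _ (MvPolynomial.pderiv j q') (fun M hM => h (j :: M) (by simpa using hM)) L hL',
        mul_comm q, mul_comm q', ih _ q q' (fun M hM => h M (by omega)) L hL']

theorem contDiff_eval {N : ℕ} (p : MvPolynomial (Fin N) ℝ) (m : WithTop ℕ∞) :
    ContDiff ℝ m fun x : Fin N → ℝ => MvPolynomial.eval x p := by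
  induction p using MvPolynomial.induction_on with
  | C a => simpa using contDiff_const
  | add p q hp hq => simpa using hp.add hq
  | mul_X p i hp => simpa using hp.mul (contDiff_apply ℝ ℝ i)

/-- The superspline module: the union of the spaces of supersplines of degree at most `d`, over all
`d`, as a module over the polynomial ring. -/
def superspline {N : ℕ} (K : Complex N) (r : Finset (Fin N → ℝ) → ℕ)
    (B : Set (Finset (Fin N → ℝ))) (s : Finset (Fin N → ℝ) → ℕ) :
    Submodule (MvPolynomial (Fin N) ℝ) (FunOn K.space) where
  carrier := {f | ∃ d, IsSuperspline K r B s d f}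
  add_mem' := by
    rintro f g ⟨d, P, hP, hc, hr, hs⟩ ⟨e, Q, hQ, hc', hr', hs'⟩
    refine ⟨max d e, fun σ => P σ + Q σ, fun σ hσ => ⟨?_, fun x hx => ?_⟩, ?_, fun τ hτ => ?_,
      fun β hβ σ hσ σ' hσ' h h' L hL x hx => ?_⟩
    · exact (MvPolynomial.totalDegree_add _ _).trans
        (max_le_max (hP σ hσ).1 (hQ σ hσ).1)
    · rw [add_apply, (hP σ hσ).2 x hx, (hQ σ hσ).2 x hx, map_add]
    · exact (hc.add hc').congr fun x hx => extendZero_add f g x hx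
    · exact ((hr τ hτ).add (hr' τ hτ)).congr
        fun x hx => extendZero_add f g x (starSpace_subset K τ hx)
    · simp only [iterPderiv_add, map_add]
      rw [hs β hβ σ hσ σ' hσ' h h' L hL x hx, hs' β hβ σ hσ σ' hσ' h h' L hL x hx]
  zero_mem' := by
    have h0 : extendZero (0 : FunOn K.space) = 0 := by
      funext x
      by_cases hx : x ∈ K.space
      · exact extendZero_apply (0 : FunOn K.space) ⟨x, hx⟩
      · exact Function.extend_apply' _ _ _ (by rintro ⟨y, rfl⟩; exact hx y.2)
    refine ⟨0, fun _ => 0, fun σ hσ => ⟨by simp, fun x hx => by simp; rfl⟩, ?_, fun τ hτ => ?_,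
      fun β hβ σ hσ σ' hσ' h h' L hL x hx => rfl⟩
    · rw [h0]; exact continuousOn_const
    · rw [h0]; exact contDiffOn_const
  smul_mem' := by
    rintro p f ⟨d, P, hP, hc, hr, hs⟩
    refine ⟨p.totalDegree + d, fun σ => p * P σ, fun σ hσ => ⟨?_, fun x hx => ?_⟩, ?_,
      fun τ hτ => ?_, fun β hβ σ hσ σ' hσ' h h' L hL x hx => ?_⟩
    · exact (MvPolynomial.totalDegree_mul _ _).trans (Nat.add_le_add_left (hP σ hσ).1 _)
    · rw [smul_apply, (hP σ hσ).2 x hx, map_mul]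
    · exact ((contDiff_eval p 0).continuous.continuousOn.mul hc).congr
        fun x hx => extendZero_smul p f x hx
    · exact ((contDiff_eval p _).contDiffOn.mul (hr τ hτ)).congr
        fun x hx => extendZero_smul p f x (starSpace_subset K τ hx)
    · exact iterPderiv_mul_eq x (s β) p _ _
        (fun M hM => hs β hβ σ hσ σ' hσ' h h' M hM x hx) L hL

/-! ### The cone over a simplicial complex -/

/-- The embedding `x ↦ (1, x)` of `ℝⁿ` in `ℝⁿ⁺¹`; the additional coordinate has index `0`. -/
def lift {n : ℕ} : (Fin n → ℝ) ↪ (Fin (n + 1) → ℝ) :=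
  ⟨fun x => Fin.cons 1 x, Fin.cons_right_injective (α := fun _ => ℝ) 1⟩

theorem zero_notMem_lift {n : ℕ} (σ : Finset (Fin n → ℝ)) :
    (0 : Fin (n + 1) → ℝ) ∉ σ.map lift := by
  intro h
  obtain ⟨x, -, hx⟩ := Finset.mem_map.1 h
  have := congrFun hx 0
  simp [lift] at this

/-- The vertices of the cone over the simplex `σ`: the origin and the lifted vertices of `σ`. -/
def coneFace {n : ℕ} (σ : Finset (Fin n → ℝ)) : Finset (Fin (n + 1) → ℝ) :=
  Finset.cons 0 (σ.map lift) (zero_notMem_lift σ)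

theorem mem_coneFace {n : ℕ} {σ : Finset (Fin n → ℝ)} {z : Fin (n + 1) → ℝ} :
    z ∈ coneFace σ ↔ z = 0 ∨ ∃ x ∈ σ, lift x = z := by
  simp [coneFace]

theorem sum_lift_eq {n : ℕ} (s : Finset (Fin n → ℝ)) (w : (Fin n → ℝ) → ℝ) :
    (∑ x ∈ s, w x • lift x) = Fin.cons (∑ x ∈ s, w x) (∑ x ∈ s, w x • x) := by
  funext j
  refine Fin.cases ?_ (fun j => ?_) j
  · simp [lift, Finset.sum_apply]
  · simp [lift, Finset.sum_apply]

theorem affineIndependent_coneFace {n : ℕ} (σ : Finset (Fin n → ℝ))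
    (h : AffineIndependent ℝ ((↑) : σ → Fin n → ℝ)) :
    AffineIndependent ℝ ((↑) : coneFace σ → Fin (n + 1) → ℝ) := by
  have hli : LinearIndependent ℝ (fun x : σ => lift x.1) := by
    rw [linearIndependent_iff']
    intro t g hg
    have h0 : ∑ x ∈ t, g x = 0 := by
      have := congrFun hg 0
      simpa [lift, Finset.sum_apply] using this
    have h1 : ∑ x ∈ t, g x • (x : Fin n → ℝ) = 0 := by
      funext j
      have := congrFun hg j.succ
      simpa [lift, Finset.sum_apply] using this
    exact (affineIndependent_iff.1 h) t g h0 h1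
  have hset : LinearIndependent ℝ
      (fun v : (Set.range fun x : σ => lift x.1) => (v : Fin (n + 1) → ℝ)) :=
    hli.linearIndepOn_id
  have hne : ∀ v ∈ (Set.range fun x : σ => lift x.1), v ≠ (0 : Fin (n + 1) → ℝ) := by
    rintro v ⟨x, rfl⟩ h0
    exact zero_notMem_lift σ (h0 ▸ Finset.mem_map_of_mem lift x.2)
  have haff := (linearIndependent_set_iff_affineIndependent_vadd_union_singleton ℝ hne
    (0 : Fin (n + 1) → ℝ)).1 hset
  refine haff.mono ?_
  intro z hz
  rcases mem_coneFace.1 hz with rfl | ⟨x, hx, rfl⟩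
  · exact Or.inl rfl
  · exact Or.inr ⟨lift x, ⟨⟨x, hx⟩, rfl⟩, by simp⟩

/-- `lift` as an affine map. -/
def liftAffine (n : ℕ) : (Fin n → ℝ) →ᵃ[ℝ] (Fin (n + 1) → ℝ) where
  toFun x := lift x
  linear :=
    { toFun := fun x => Fin.cons 0 x
      map_add' := fun x y => by
        funext j; refine Fin.cases ?_ (fun j => ?_) j <;> simp
      map_smul' := fun c x => by
        funext j; refine Fin.cases ?_ (fun j => ?_) j <;> simp }
  map_vadd' x v := by
    funext j; refine Fin.cases ?_ (fun j => ?_) j <;> simp [lift]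

theorem mem_hull_map {n : ℕ} {σ : Set (Fin n → ℝ)} {z : Fin (n + 1) → ℝ} :
    z ∈ convexHull ℝ (lift '' σ) ↔ ∃ y ∈ convexHull ℝ σ, lift y = z := by
  have h := (liftAffine n).image_convexHull σ
  have h' : convexHull ℝ (lift '' σ) = lift '' convexHull ℝ σ := h.symm
  rw [h']; rfl

theorem mem_hull_cone {n : ℕ} {σ : Set (Fin n → ℝ)} {z : Fin (n + 1) → ℝ} :
    z ∈ convexHull ℝ (insert 0 (lift '' σ)) ↔
      z = 0 ∨ ∃ b : ℝ, 0 < b ∧ b ≤ 1 ∧ ∃ y ∈ convexHull ℝ σ, z = b • lift y := by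
  rcases σ.eq_empty_or_nonempty with rfl | hσ
  · simp
  rw [convexHull_insert (hσ.image _), mem_convexJoin]
  constructor
  · rintro ⟨u, hu, v, hv, hz⟩
    obtain ⟨y, hy, rfl⟩ := mem_hull_map.1 hv
    rw [Set.mem_singleton_iff] at hu
    subst hu
    obtain ⟨a, b, ha, hb, hab, rfl⟩ := hz
    rcases hb.eq_or_lt with rfl | hb
    · left; simp
    · exact Or.inr ⟨b, hb, by linarith, y, hy, by simp⟩
  · rintro (rfl | ⟨b, hb, hb1, y, hy, rfl⟩)
    · obtain ⟨x, hx⟩ := hσ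
      exact ⟨0, rfl, lift x, subset_convexHull _ _ ⟨x, hx, rfl⟩, left_mem_segment _ _ _⟩
    · exact ⟨0, rfl, lift y, mem_hull_map.2 ⟨y, hy, rfl⟩, 1 - b, b, by linarith, hb.le, by ring,
        by simp⟩

theorem smul_lift_zero {n : ℕ} (b : ℝ) (y : Fin n → ℝ) : (b • lift y) 0 = b := by
  simp [lift]

theorem smul_lift_inj {n : ℕ} {a b : ℝ} (ha : 0 < a) {x y : Fin n → ℝ}
    (h : a • lift x = b • lift y) : a = b ∧ x = y := by
  have hab : a = b := by
    have := congrFun h 0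
    rwa [smul_lift_zero, smul_lift_zero] at this
  subst hab
  exact ⟨rfl, lift.injective (smul_right_injective _ ha.ne' h)⟩

/-- The set of faces of the cone: the cones `coneFace σ` over the faces of `K`, the origin (the case
`σ = ∅`), and the lifted faces of `K`, which are the remaining faces of these cones. -/
def coneFaces {n : ℕ} (K : Complex n) : Set (Finset (Fin (n + 1) → ℝ)) :=
  {t | ∃ σ : Finset (Fin n → ℝ), (σ ∈ K.faces ∧ (t = coneFace σ ∨ t = σ.map lift)) ∨
    (σ = ∅ ∧ t = coneFace σ)}

theorem hull_inter {n : ℕ} (K : Complex n) {σ σ' : Finset (Fin n → ℝ)}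
    (hσ : σ = ∅ ∨ σ ∈ K.faces) (hσ' : σ' = ∅ ∨ σ' ∈ K.faces) {y : Fin n → ℝ}
    (h : y ∈ convexHull ℝ (σ : Set (Fin n → ℝ))) (h' : y ∈ convexHull ℝ (σ' : Set (Fin n → ℝ))) :
    y ∈ convexHull ℝ ((σ : Set (Fin n → ℝ)) ∩ σ') := by
  rcases hσ with rfl | hσ
  · simp at h
  rcases hσ' with rfl | hσ'
  · simp at h'
  exact K.inter_subset_convexHull hσ hσ' ⟨h, h'⟩

theorem coe_coneFace {n : ℕ} (σ : Finset (Fin n → ℝ)) :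
    (coneFace σ : Set (Fin (n + 1) → ℝ)) = insert 0 (lift '' (σ : Set (Fin n → ℝ))) := by
  ext z
  simp [coneFace]

/-- The cone over `K`, a simplicial complex in `ℝⁿ⁺¹` with apex the origin. -/
def cone {n : ℕ} (K : Complex n) : Complex (n + 1) where
  faces := coneFaces K
  isRelLowerSet_faces := by
    rintro t ht
    refine ⟨?_, fun u hu hne => ?_⟩
    · obtain ⟨σ, ⟨hσ, rfl | rfl⟩ | ⟨rfl, rfl⟩⟩ := ht
      · exact ⟨0, mem_coneFace.2 (Or.inl rfl)⟩
      · exact (K.nonempty_of_mem_faces hσ).map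
      · exact ⟨0, mem_coneFace.2 (Or.inl rfl)⟩
    · classical
      obtain ⟨σ, hσ, hsub⟩ : ∃ σ : Finset (Fin n → ℝ), (σ = ∅ ∨ σ ∈ K.faces) ∧ u ⊆ coneFace σ := by
        obtain ⟨σ, ⟨hσ, rfl | rfl⟩ | ⟨rfl, rfl⟩⟩ := ht
        · exact ⟨σ, Or.inr hσ, hu⟩
        · exact ⟨σ, Or.inr hσ, hu.trans (Finset.subset_cons _)⟩
        · exact ⟨∅, Or.inl rfl, hu⟩
      have hρ : σ.filter (fun x => lift x ∈ u) = ∅ ∨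
          σ.filter (fun x => lift x ∈ u) ∈ K.faces := by
        rcases Finset.eq_empty_or_nonempty (σ.filter (fun x => lift x ∈ u)) with h | h
        · exact Or.inl h
        · rcases hσ with rfl | hσ
          · simp at h
          · exact Or.inr (K.down_closed hσ (Finset.filter_subset _ _) h)
      by_cases h0 : (0 : Fin (n + 1) → ℝ) ∈ u
      · have hu' : u = coneFace (σ.filter fun x => lift x ∈ u) := by
          ext z
          rw [mem_coneFace]
          constructor
          · intro hz
            rcases mem_coneFace.1 (hsub hz) with rfl | ⟨x, hx, rfl⟩
            · exact Or.inl rfl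
            · exact Or.inr ⟨x, by simp [hx, hz], rfl⟩
          · rintro (rfl | ⟨x, hx, rfl⟩)
            · exact h0
            · exact (Finset.mem_filter.1 hx).2
        rcases hρ with h | h
        · exact ⟨_, Or.inr ⟨h, hu'⟩⟩
        · exact ⟨_, Or.inl ⟨h, Or.inl hu'⟩⟩
      · have hu' : u = (σ.filter fun x => lift x ∈ u).map lift := by
          ext z
          rw [Finset.mem_map]
          constructor
          · intro hz
            rcases mem_coneFace.1 (hsub hz) with rfl | ⟨x, hx, rfl⟩
            · exact absurd hz h0
            · exact ⟨x, by simp [hx, hz], rfl⟩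
          · rintro ⟨x, hx, rfl⟩
            exact (Finset.mem_filter.1 hx).2
        rcases hρ with h | h
        · rw [h, Finset.map_empty] at hu'
          exact absurd hu' hne.ne_empty
        · exact ⟨_, Or.inl ⟨h, Or.inr hu'⟩⟩
  indep := by
    rintro t ⟨σ, ⟨hσ, rfl | rfl⟩ | ⟨rfl, rfl⟩⟩
    · exact affineIndependent_coneFace σ (K.indep hσ)
    · exact (affineIndependent_coneFace σ (K.indep hσ)).mono
        (t := (coneFace σ : Set (Fin (n + 1) → ℝ))) (Finset.coe_subset.2 (Finset.subset_cons _))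
    · refine affineIndependent_coneFace ∅ ?_
      exact affineIndependent_of_subsingleton ℝ _
  inter_subset_convexHull := by
    have key : ∀ {t : Finset (Fin (n + 1) → ℝ)}, t ∈ coneFaces K →
        ∃ σ : Finset (Fin n → ℝ), (σ = ∅ ∨ σ ∈ K.faces) ∧
          ((t : Set (Fin (n + 1) → ℝ)) = insert 0 (lift '' (σ : Set (Fin n → ℝ))) ∨
            (t : Set (Fin (n + 1) → ℝ)) = lift '' (σ : Set (Fin n → ℝ))) := by
      rintro t ⟨σ, ⟨hσ, rfl | rfl⟩ | ⟨rfl, rfl⟩⟩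
      · exact ⟨σ, Or.inr hσ, Or.inl (coe_coneFace σ)⟩
      · exact ⟨σ, Or.inr hσ, Or.inr (Finset.coe_map _ _)⟩
      · exact ⟨∅, Or.inl rfl, Or.inl (coe_coneFace ∅)⟩
    have img : ∀ A B : Set (Fin n → ℝ), lift '' (A ∩ B) = lift '' A ∩ lift '' B :=
      fun A B => Set.image_inter lift.injective
    rintro s t hs ht z ⟨hzs, hzt⟩
    obtain ⟨σ, hσ, es⟩ := key hs
    obtain ⟨σ', hσ', et⟩ := key ht
    rcases es with es | es <;> rcases et with et | et <;> rw [es] at hzs ⊢ <;> rw [et] at hzt ⊢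
    · rw [← Set.insert_inter_distrib, ← img]
      rw [mem_hull_cone] at hzs hzt ⊢
      rcases hzs with h | ⟨a, ha, ha1, x, hx, hzx⟩
      · exact Or.inl h
      rcases hzt with h | ⟨b, hb, hb1, y, hy, hzy⟩
      · exact Or.inl h
      obtain ⟨rfl, rfl⟩ := smul_lift_inj ha (hzx.symm.trans hzy)
      exact Or.inr ⟨a, ha, ha1, x, hull_inter K hσ hσ' hx hy, hzx⟩
    · have hsub : lift '' ((σ : Set (Fin n → ℝ)) ∩ σ') ⊆
          insert 0 (lift '' (σ : Set (Fin n → ℝ))) ∩ lift '' (σ' : Set (Fin n → ℝ)) := by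
        rw [img]; exact Set.inter_subset_inter_left _ (Set.subset_insert _ _)
      refine convexHull_mono hsub ?_
      rw [mem_hull_cone] at hzs
      rw [mem_hull_map] at hzt ⊢
      obtain ⟨y, hy, rfl⟩ := hzt
      rcases hzs with h | ⟨a, ha, ha1, x, hx, hzx⟩
      · have := congrFun h 0
        simp [lift] at this
      · have hzx' : a • lift x = (1 : ℝ) • lift y := by rw [one_smul, hzx]
        obtain ⟨-, rfl⟩ := smul_lift_inj ha hzx'
        exact ⟨x, hull_inter K hσ hσ' hx hy, rfl⟩
    · have hsub : lift '' ((σ : Set (Fin n → ℝ)) ∩ σ') ⊆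
          lift '' (σ : Set (Fin n → ℝ)) ∩ insert 0 (lift '' (σ' : Set (Fin n → ℝ))) := by
        rw [img]; exact Set.inter_subset_inter_right _ (Set.subset_insert _ _)
      refine convexHull_mono hsub ?_
      rw [mem_hull_cone] at hzt
      rw [mem_hull_map] at hzs ⊢
      obtain ⟨y, hy, rfl⟩ := hzs
      rcases hzt with h | ⟨a, ha, ha1, x, hx, hzx⟩
      · have := congrFun h 0
        simp [lift] at this
      · have hzx' : a • lift x = (1 : ℝ) • lift y := by rw [one_smul, hzx]
        obtain ⟨-, rfl⟩ := smul_lift_inj ha hzx'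
        exact ⟨x, hull_inter K hσ hσ' hy hx, rfl⟩
    · rw [← img]
      rw [mem_hull_map] at hzs hzt ⊢
      obtain ⟨x, hx, rfl⟩ := hzs
      obtain ⟨y, hy, hyx⟩ := hzt
      obtain rfl := lift.injective hyx
      exact ⟨y, hull_inter K hσ hσ' hx hy, rfl⟩

/-- The face `σ` recovered from a face `coneFace σ` of the cone. -/
def baseFace {n : ℕ} (t : Finset (Fin (n + 1) → ℝ)) : Finset (Fin n → ℝ) :=
  t.preimage lift lift.injective.injOn

theorem baseFace_coneFace {n : ℕ} (σ : Finset (Fin n → ℝ)) : baseFace (coneFace σ) = σ := by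
  ext x
  rw [baseFace, Finset.mem_preimage, mem_coneFace]
  constructor
  · rintro (h | ⟨y, hy, h⟩)
    · have := congrFun h 0
      simp [lift] at this
    · exact lift.injective h ▸ hy
  · exact fun hx => Or.inr ⟨x, hx, rfl⟩

/-- The superspline module on the cone over `K`, for smoothness `r` and supersmoothness `s` on `K`:
smoothness `r τ` across the cone over each interior codimension one face `τ`, supersmoothness `s β`
at the cone over each `i`-face `β` of `K`. -/
def coneSuperspline {n : ℕ} (K : Complex n) (i : ℕ) (r s : Finset (Fin n → ℝ) → ℕ) :
    Submodule (MvPolynomial (Fin (n + 1)) ℝ) (FunOn (cone K).space) :=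
  superspline (cone K) (fun t => r (baseFace t)) (coneFace '' facesOfDim K i)
    (fun t => s (baseFace t))

/-! ### The ideals attached to the faces -/

/-- The homogenization of a polynomial with respect to the additional variable `X 0`. -/
def homogenization {n : ℕ} (p : MvPolynomial (Fin n) ℝ) : MvPolynomial (Fin (n + 1)) ℝ :=
  ∑ m ∈ p.support, MvPolynomial.monomial (Finsupp.cons (p.totalDegree - m.degree) m) (p.coeff m)

/-- The ideal generated by the homogenizations of all polynomials vanishing on the simplex `β`. -/
def homVanishingIdeal {n : ℕ} (β : Finset (Fin n → ℝ)) : Ideal (MvPolynomial (Fin (n + 1)) ℝ) :=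
  Ideal.span (homogenization ''
    (MvPolynomial.vanishingIdeal ℝ (convexHull ℝ (β : Set (Fin n → ℝ))) :
      Set (MvPolynomial (Fin n) ℝ)))

/-- `ℓ` is a nonzero linear form vanishing on the cone over `τ`. -/
def IsLinearFormOf {n : ℕ} (ℓ : MvPolynomial (Fin (n + 1)) ℝ) (τ : Finset (Fin n → ℝ)) : Prop :=
  ℓ ≠ 0 ∧ ℓ.IsHomogeneous 1 ∧
    ∀ x ∈ convexHull ℝ (coneFace τ : Set (Fin (n + 1) → ℝ)), MvPolynomial.eval x ℓ = 0

/-- The ideal of a codimension one face `τ`, where `ℓ τ` is the chosen linear form of `τ`. -/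
def facetIdeal {n : ℕ} (K : Complex n) (i : ℕ) (r s : Finset (Fin n → ℝ) → ℕ)
    (ℓ : Finset (Fin n → ℝ) → MvPolynomial (Fin (n + 1)) ℝ) (τ : Finset (Fin n → ℝ)) :
    Ideal (MvPolynomial (Fin (n + 1)) ℝ) :=
  Ideal.span {ℓ τ ^ (r τ + 1)} ⊓
    ⨅ β ∈ facesOfDim K i, ⨅ _ : β ⊆ τ, homVanishingIdeal β ^ (s β + 1)

/-- The ideal of an arbitrary face `γ`: the sum of the ideals of the interior codimension one faces
that contain `γ`. For an `n`-face this is the zero ideal and for an interior codimension one face it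
is its `facetIdeal`, see `faceIdeal_top` and `faceIdeal_facet`. -/
def faceIdeal {n : ℕ} (K : Complex n) (i : ℕ) (r s : Finset (Fin n → ℝ) → ℕ)
    (ℓ : Finset (Fin n → ℝ) → MvPolynomial (Fin (n + 1)) ℝ) (γ : Finset (Fin n → ℝ)) :
    Ideal (MvPolynomial (Fin (n + 1)) ℝ) :=
  ⨆ τ ∈ interiorFaces K (n - 1), ⨆ _ : γ ⊆ τ, facetIdeal K i r s ℓ τ

theorem faceIdeal_top {n : ℕ} (hn : 1 ≤ n) (K : Complex n) (i : ℕ)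
    (r s : Finset (Fin n → ℝ) → ℕ) (ℓ : Finset (Fin n → ℝ) → MvPolynomial (Fin (n + 1)) ℝ)
    {σ : Finset (Fin n → ℝ)} (hσ : σ ∈ facesOfDim K n) : faceIdeal K i r s ℓ σ = ⊥ := by
  refine le_bot_iff.1 (iSup₂_le fun τ hτ => iSup_le fun h => ?_)
  have h1 := Finset.card_le_card h
  have h2 := hτ.1.2
  have h3 := hσ.2
  omega

theorem faceIdeal_facet {n : ℕ} (K : Complex n) (i : ℕ)
    (r s : Finset (Fin n → ℝ) → ℕ) (ℓ : Finset (Fin n → ℝ) → MvPolynomial (Fin (n + 1)) ℝ)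
    {τ : Finset (Fin n → ℝ)} (hτ : τ ∈ interiorFaces K (n - 1)) :
    faceIdeal K i r s ℓ τ = facetIdeal K i r s ℓ τ := by
  refine le_antisymm (iSup₂_le fun τ' hτ' => iSup_le fun h => ?_)
    (le_iSup₂_of_le τ hτ (le_iSup_of_le subset_rfl le_rfl))
  have e : τ = τ' := Finset.eq_of_subset_of_card_le h (by rw [hτ.1.2, hτ'.1.2])
  rw [e]

theorem faceIdeal_mono {n : ℕ} (K : Complex n) (i : ℕ)
    (r s : Finset (Fin n → ℝ) → ℕ) (ℓ : Finset (Fin n → ℝ) → MvPolynomial (Fin (n + 1)) ℝ)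
    {γ β : Finset (Fin n → ℝ)} (h : γ ⊆ β) :
    faceIdeal K i r s ℓ β ≤ faceIdeal K i r s ℓ γ :=
  iSup₂_le fun τ hτ => iSup_le fun hβ =>
    le_iSup₂_of_le τ hτ (le_iSup_of_le (h.trans hβ) le_rfl)

/-! ### The chain complexes -/

/-- The polynomial ring `ℝ[x₀, …, xₙ]`. -/
abbrev PolyRing (n : ℕ) := MvPolynomial (Fin (n + 1)) ℝ

/-- The free module on the interior `j`-faces. -/
abbrev chains {n : ℕ} (K : Complex n) (j : ℕ) := interiorFaces K j →₀ PolyRing n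

open Classical in
/-- The basis element `[γ]` if `γ` is an interior `j`-face, and zero otherwise. -/
def symbol {n : ℕ} (K : Complex n) (j : ℕ) (γ : Finset (Fin n → ℝ)) : chains K j :=
  if h : γ ∈ interiorFaces K j then Finsupp.single ⟨γ, h⟩ 1 else 0

open Classical in
/-- The incidence sign `(-1)ᵏ`, where `v` is the vertex in position `k` (counted from `0`) of `β`
when the vertices are ordered by `lt`. -/
def incidenceSign {n : ℕ} (lt : (Fin n → ℝ) → (Fin n → ℝ) → Prop) (β : Finset (Fin n → ℝ))
    (v : Fin n → ℝ) : PolyRing n :=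
  (-1) ^ (β.filter fun w => lt w v).card

open Classical in
/-- The simplicial boundary map relative to the boundary of `K`, from `j`-chains to `k`-chains (it
is zero unless `j = k + 1`), for the orientation of the faces given by the vertex ordering `lt`. -/
def boundaryMap {n : ℕ} (lt : (Fin n → ℝ) → (Fin n → ℝ) → Prop) (K : Complex n) (j k : ℕ) :
    chains K j →ₗ[PolyRing n] chains K k :=
  Finsupp.linearCombination (PolyRing n) fun β : interiorFaces K j =>
    ∑ v ∈ β.1, incidenceSign lt β.1 v • symbol K k (β.1.erase v)

/-- The chains whose coefficient at each face lies in the ideal of the face. -/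
def idealChains {n : ℕ} (K : Complex n) (i : ℕ) (r s : Finset (Fin n → ℝ) → ℕ)
    (ℓ : Finset (Fin n → ℝ) → PolyRing n) (j : ℕ) : Submodule (PolyRing n) (chains K j) where
  carrier := {c | ∀ β, c β ∈ faceIdeal K i r s ℓ β.1}
  add_mem' := fun {a b} h h' β => by
    rw [Finsupp.add_apply]
    exact Ideal.add_mem _ (h β) (h' β)
  zero_mem' := fun β => by
    rw [Finsupp.zero_apply]
    exact Ideal.zero_mem _
  smul_mem' := fun p c h β => by
    rw [Finsupp.smul_apply, smul_eq_mul]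
    exact Ideal.mul_mem_left _ p (h β)

theorem interiorFaces_of_subset {n : ℕ} {K : Complex n} {j : ℕ} {γ δ : Finset (Fin n → ℝ)}
    (hδ : δ ∈ K.faces) (hj : δ.card = j + 1) (hγ : ¬ IsBoundaryFace K γ) (h : γ ⊆ δ) :
    δ ∈ interiorFaces K j :=
  ⟨⟨hδ, hj⟩, fun ⟨τ, hτ, hc, hs, hu⟩ => hγ ⟨τ, hτ, hc, h.trans hs, hu⟩⟩

theorem boundaryMap_single {n : ℕ} (lt : (Fin n → ℝ) → (Fin n → ℝ) → Prop) (K : Complex n)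
    (j k : ℕ) (β : interiorFaces K j) :
    boundaryMap lt K j k (Finsupp.single β 1) = by
      classical exact ∑ v ∈ β.1, incidenceSign lt β.1 v • symbol K k (β.1.erase v) := by
  simp only [boundaryMap, Finsupp.linearCombination_single, one_smul]

theorem boundaryMap_mem {n : ℕ} (lt : (Fin n → ℝ) → (Fin n → ℝ) → Prop) (K : Complex n) (i : ℕ)
    (r s : Finset (Fin n → ℝ) → ℕ) (ℓ : Finset (Fin n → ℝ) → PolyRing n) (j k : ℕ) :
    idealChains K i r s ℓ j ≤ (idealChains K i r s ℓ k).comap (boundaryMap lt K j k) := by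
  classical
  intro c hc
  rw [Submodule.mem_comap, boundaryMap, Finsupp.linearCombination_apply]
  refine Submodule.sum_mem _ fun β _ => ?_
  simp only [Finset.smul_sum]
  refine Submodule.sum_mem _ fun v _ => ?_
  intro γ
  rw [smul_smul, Finsupp.smul_apply, smul_eq_mul, symbol]
  split_ifs with h
  · by_cases e : γ = ⟨β.1.erase v, h⟩
    · subst e
      have := faceIdeal_mono K i r s ℓ (Finset.erase_subset v β.1) (hc β)
      rw [mul_assoc]
      exact Ideal.mul_mem_right _ _ this
    · rw [Finsupp.single_eq_of_ne e]
      simp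
  · simp

theorem incidenceSign_swap {n : ℕ} (lt : (Fin n → ℝ) → (Fin n → ℝ) → Prop)
    [IsStrictTotalOrder (Fin n → ℝ) lt] (β : Finset (Fin n → ℝ)) {v w : Fin n → ℝ}
    (hv : v ∈ β) (hw : w ∈ β) (hvw : lt v w) [DecidableEq (Fin n → ℝ)] :
    incidenceSign lt β v * incidenceSign lt (β.erase v) w +
      incidenceSign lt β w * incidenceSign lt (β.erase w) v = 0 := by
  classical
  have h1 : ((β.erase w).filter fun u => lt u v) = β.filter fun u => lt u v := by
    ext u
    simp only [Finset.mem_filter, Finset.mem_erase]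
    constructor
    · exact fun h => ⟨h.1.2, h.2⟩
    · refine fun h => ⟨⟨?_, h.1⟩, h.2⟩
      rintro rfl
      exact asymm_of lt h.2 hvw
  have h2 : (β.filter fun u => lt u w).card = ((β.erase v).filter fun u => lt u w).card + 1 := by
    have e : ((β.erase v).filter fun u => lt u w) = (β.filter fun u => lt u w).erase v := by
      ext u
      simp only [Finset.mem_filter, Finset.mem_erase]
      tauto
    rw [e, Finset.card_erase_add_one (Finset.mem_filter.2 ⟨hv, hvw⟩)]
  simp only [incidenceSign]
  rw [h1, h2]
  ring

theorem boundaryMap_comp {n : ℕ} (lt : (Fin n → ℝ) → (Fin n → ℝ) → Prop)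
    [IsStrictTotalOrder (Fin n → ℝ) lt] (K : Complex n) (k : ℕ) :
    boundaryMap lt K (k + 1) k ∘ₗ boundaryMap lt K (k + 2) (k + 1) = 0 := by
  classical
  refine Finsupp.lhom_ext' fun β => LinearMap.ext_ring ?_
  simp only [LinearMap.comp_apply, Finsupp.lsingle_apply, LinearMap.zero_apply]
  rw [boundaryMap_single, map_sum]
  have step : ∀ v ∈ β.1, boundaryMap lt K (k + 1) k
      (incidenceSign lt β.1 v • symbol K (k + 1) (β.1.erase v)) =
      ∑ w ∈ β.1.erase v, (incidenceSign lt β.1 v * incidenceSign lt (β.1.erase v) w) •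
        symbol K k ((β.1.erase v).erase w) := by
    intro v hv
    have hcard : (β.1.erase v).card = k + 1 + 1 := by
      rw [Finset.card_erase_of_mem hv, β.2.1.2]; omega
    have hface : β.1.erase v ∈ K.faces :=
      K.down_closed β.2.1.1 (Finset.erase_subset _ _) (Finset.card_pos.1 (by omega))
    rw [map_smul]
    by_cases h : β.1.erase v ∈ interiorFaces K (k + 1)
    · rw [symbol, dif_pos h, boundaryMap_single, Finset.smul_sum]
      refine Finset.sum_congr rfl fun w _ => ?_
      rw [smul_smul]
    · rw [symbol, dif_neg h, map_zero, smul_zero]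
      refine (Finset.sum_eq_zero fun w _ => ?_).symm
      rw [symbol, dif_neg, smul_zero]
      exact fun h' => h (interiorFaces_of_subset hface hcard h'.2 (Finset.erase_subset _ _))
  rw [Finset.sum_congr rfl step, Finset.sum_sigma']
  refine Finset.sum_involution (fun a _ => ⟨a.2, a.1⟩) ?_ ?_ ?_ ?_
  · rintro ⟨v, w⟩ ha
    simp only [Finset.mem_sigma, Finset.mem_erase] at ha
    obtain ⟨hv, hwv, hw⟩ := ha
    simp only
    rw [Finset.erase_right_comm (a := w) (b := v), ← add_smul]
    have hz : incidenceSign lt β.1 v * incidenceSign lt (β.1.erase v) w +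
        incidenceSign lt β.1 w * incidenceSign lt (β.1.erase w) v = 0 := by
      rcases trichotomous_of lt v w with h | h | h
      · exact incidenceSign_swap lt β.1 hv hw h
      · exact absurd h.symm hwv
      · rw [add_comm]
        exact incidenceSign_swap lt β.1 hw hv h
    rw [hz, zero_smul]
  · rintro ⟨v, w⟩ ha - e
    simp only [Finset.mem_sigma, Finset.mem_erase] at ha
    exact ha.2.1 (congrArg Sigma.fst e)
  · rintro ⟨v, w⟩ ha
    simp only [Finset.mem_sigma, Finset.mem_erase] at ha ⊢
    exact ⟨ha.2.2, fun e => ha.2.1 e.symm, ha.1⟩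
  · rintro ⟨v, w⟩ ha
    rfl

theorem boundaryMap_shape {n : ℕ} (lt : (Fin n → ℝ) → (Fin n → ℝ) → Prop) (K : Complex n)
    (j k : ℕ) (h : k + 1 ≠ j) : boundaryMap lt K j k = 0 := by
  classical
  refine Finsupp.lhom_ext' fun β => LinearMap.ext_ring ?_
  simp only [LinearMap.comp_apply, Finsupp.lsingle_apply, LinearMap.zero_apply]
  rw [boundaryMap_single]
  refine Finset.sum_eq_zero fun v hv => ?_
  rw [symbol, dif_neg, smul_zero]
  intro h'
  have h1 := h'.1.2
  have h2 := β.2.1.2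
  rw [Finset.card_erase_of_mem hv] at h1
  omega

/-- The map induced by the boundary map on the quotients by the chains with coefficients in the
ideals. -/
def quotientBoundary {n : ℕ} (lt : (Fin n → ℝ) → (Fin n → ℝ) → Prop) (K : Complex n) (i : ℕ)
    (r s : Finset (Fin n → ℝ) → ℕ) (ℓ : Finset (Fin n → ℝ) → PolyRing n) (j k : ℕ) :
    (chains K j ⧸ idealChains K i r s ℓ j) →ₗ[PolyRing n]
      (chains K k ⧸ idealChains K i r s ℓ k) :=
  Submodule.mapQ _ _ (boundaryMap lt K j k) (boundaryMap_mem lt K i r s ℓ j k)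

/-- The quotient of the relative simplicial chain complex with coefficients in `ℝ[x₀, …, xₙ]` by the
subcomplex of the chains with coefficients in the ideals of the faces. -/
def quotientComplex {n : ℕ} (lt : (Fin n → ℝ) → (Fin n → ℝ) → Prop)
    [IsStrictTotalOrder (Fin n → ℝ) lt] (K : Complex n) (i : ℕ)
    (r s : Finset (Fin n → ℝ) → ℕ) (ℓ : Finset (Fin n → ℝ) → PolyRing n) :
    ChainComplex (ModuleCat (PolyRing n)) ℕ where
  X j := ModuleCat.of (PolyRing n) (chains K j ⧸ idealChains K i r s ℓ j)
  d j k := ModuleCat.ofHom (quotientBoundary lt K i r s ℓ j k)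
  shape j k h := by
    have e : quotientBoundary lt K i r s ℓ j k = 0 := by
      refine Submodule.linearMap_qext _ (LinearMap.ext fun c => ?_)
      simp [quotientBoundary, boundaryMap_shape lt K j k h]
    rw [e]; rfl
  d_comp_d' j k l hjk hkl := by
    obtain rfl : k + 1 = j := hjk
    obtain rfl : l + 1 = k := hkl
    have e : quotientBoundary lt K i r s ℓ (l + 1) l ∘ₗ
        quotientBoundary lt K i r s ℓ (l + 1 + 1) (l + 1) = 0 := by
      refine Submodule.linearMap_qext _ (LinearMap.ext fun c => ?_)
      have := LinearMap.congr_fun (boundaryMap_comp lt K l) c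
      simp only [LinearMap.comp_apply, LinearMap.zero_apply] at this
      simp [quotientBoundary, this]
    rw [← ModuleCat.ofHom_comp, e]; rfl

end SuperSpline

end

namespace SuperSpline

open MvPolynomial

/-! The lifted vertices of an `n`-face form a basis of `ℝⁿ⁺¹`, so a polynomial is determined by its
values on the cone over an `n`-face. A spline is thus a family of polynomials `P σ`, and the theorem
amounts to rewriting its conditions as `IsCompatible`: `P σ - P σ' ∈ J(τ)` whenever the `n`-faces
`σ`, `σ'` contain the interior `(n-1)`-face `τ`.

Two local facts do this. Smoothness `C^r` across the cone over `τ` means that `ℓ ^ (r + 1)` divides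
the difference of the two pieces (`linForm_pow_dvd_of_contDiffOn`, `contDiffOn_of_linForm_pow_dvd`).
Vanishing of all derivatives of order at most `s` on the cone over `β` means membership in the `(s +
1)`-st power of the ideal of `β` (`mem_homVanishingIdeal_pow_iff`), by a Taylor expansion about the
projection onto the span of that cone.

Conversely, compatibility concerns only adjacent `n`-faces. Heredity joins `σ` to `σ'` by `n`-faces
containing `σ ∩ σ'`, and the differences telescope (`IsCompatible.sub_mem`). This gives
supersmoothness at every `i`-face and agreement of the pieces on overlaps away from the apex. At the
apex even the cones over disjoint `n`-faces meet; there connectedness of `|Δ|` forces agreement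
(`IsCompatible.eval_zero_eq`).

An interior `(n-1)`-face lies in exactly two `n`-faces, on opposite sides (`coneCoord_neg`,
`eq_of_three_faces`). If `ε σ` is the sign of the determinant of the ordered lifted vertices, the
two induced orientations cancel (`exists_orientation`), so the boundary of `∑ ε σ P σ [σ]` has
coefficient `±(P σ - P σ')` at `τ`. Hence compatibility says that this boundary lies in `𝒥ₙ₋₁`; as
`𝒥ₙ = 0`, such chains are exactly the kernel of the top differential. -/

/-! ### Polynomials vanishing to high order along a subspace -/

/-- The polynomial `Q(π + T z)` in the additional variable `T`. -/
noncomputable def taylorPoly {N : ℕ} (π z : Fin N → MvPolynomial (Fin N) ℝ)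
    (Q : MvPolynomial (Fin N) ℝ) : Polynomial (MvPolynomial (Fin N) ℝ) :=
  aeval (fun j => Polynomial.C (π j) + Polynomial.X * Polynomial.C (z j)) Q

theorem taylorPoly_eval_one {N : ℕ} (π z : Fin N → MvPolynomial (Fin N) ℝ)
    (h : ∀ j, π j + z j = X j) (Q : MvPolynomial (Fin N) ℝ) :
    (taylorPoly π z Q).eval 1 = Q := by
  induction Q using MvPolynomial.induction_on with
  | C a =>
    simp only [taylorPoly, algHom_C]
    rw [IsScalarTower.algebraMap_apply ℝ (MvPolynomial (Fin N) ℝ)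
      (Polynomial (MvPolynomial (Fin N) ℝ))]
    simp [algebraMap_eq]
  | add p q hp hq => simp only [taylorPoly, map_add, Polynomial.eval_add] at *; rw [hp, hq]
  | mul_X p j hp =>
    simp only [taylorPoly, map_mul, aeval_X, Polynomial.eval_mul] at *
    rw [hp]
    simp [h]

/-- Every factor `T` in the expansion of `Q(π + T z)` comes with a factor `z j`. -/
theorem taylorPoly_coeff_mem {N : ℕ} (π z : Fin N → MvPolynomial (Fin N) ℝ)
    (I : Ideal (MvPolynomial (Fin N) ℝ)) (hz : ∀ j, z j ∈ I) (Q : MvPolynomial (Fin N) ℝ) (k : ℕ) :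
    (taylorPoly π z Q).coeff k ∈ I ^ k := by
  induction Q using MvPolynomial.induction_on generalizing k with
  | C a =>
    simp only [taylorPoly, algHom_C]
    rw [IsScalarTower.algebraMap_apply ℝ (MvPolynomial (Fin N) ℝ)
      (Polynomial (MvPolynomial (Fin N) ℝ)), Polynomial.algebraMap_apply, Algebra.algebraMap_self_apply,
      Polynomial.coeff_C]
    split_ifs with h
    · subst h; simp
    · simp
  | add p q hp hq =>
    simp only [taylorPoly, map_add, Polynomial.coeff_add] at *
    exact Ideal.add_mem _ (hp k) (hq k)
  | mul_X p j hp =>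
    simp only [taylorPoly, map_mul, aeval_X] at *
    rw [mul_add, Polynomial.coeff_add, Polynomial.coeff_mul_C, ← mul_assoc, Polynomial.coeff_mul_C]
    refine Ideal.add_mem _ (Ideal.mul_mem_right _ _ (hp k)) ?_
    cases k with
    | zero => simp
    | succ k =>
      rw [Polynomial.coeff_mul_X, pow_succ]
      exact Ideal.mul_mem_mul (hp k) (hz j)

/-- This is the chain rule in the variable `T`; it lets the low coefficients be computed from
partial derivatives of `Q` at `π`. -/
theorem taylorPoly_derivative {N : ℕ} (π z : Fin N → MvPolynomial (Fin N) ℝ)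
    (Q : MvPolynomial (Fin N) ℝ) :
    (taylorPoly π z Q).derivative = ∑ j, Polynomial.C (z j) * taylorPoly π z (pderiv j Q) := by
  induction Q using MvPolynomial.induction_on with
  | C a =>
    simp only [taylorPoly, algHom_C]
    rw [IsScalarTower.algebraMap_apply ℝ (MvPolynomial (Fin N) ℝ)
      (Polynomial (MvPolynomial (Fin N) ℝ)), Polynomial.algebraMap_apply]
    simp
  | add p q hp hq =>
    simp only [taylorPoly, map_add, mul_add, Finset.sum_add_distrib] at *
    rw [hp, hq]
  | mul_X p i hp =>
    have e : ∀ j, pderiv j (p * X i) = pderiv j p * X i + if i = j then p else 0 := by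
      intro j
      rw [Derivation.leibniz, pderiv_X, Pi.single_apply]
      split_ifs <;> simp [mul_comm, add_comm]
    simp only [e]
    simp only [taylorPoly, map_mul, map_add, aeval_X, Polynomial.derivative_mul] at *
    rw [hp]
    simp only [mul_add, Finset.sum_add_distrib, apply_ite (aeval _), map_zero, mul_ite, mul_zero,
      Finset.sum_ite_eq, Finset.mem_univ, if_true, Polynomial.derivative_C, Polynomial.derivative_X,
      Finset.sum_mul]
    simp only [← mul_assoc]
    ring

theorem taylorPoly_coeff_zero {N : ℕ} (π z : Fin N → MvPolynomial (Fin N) ℝ)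
    (Q : MvPolynomial (Fin N) ℝ) : (taylorPoly π z Q).coeff 0 = aeval π Q := by
  induction Q using MvPolynomial.induction_on with
  | C a =>
    simp only [taylorPoly, algHom_C]
    rw [IsScalarTower.algebraMap_apply ℝ (MvPolynomial (Fin N) ℝ)
      (Polynomial (MvPolynomial (Fin N) ℝ)), Polynomial.algebraMap_apply]
    simp
  | add p q hp hq => simp only [taylorPoly, map_add, Polynomial.coeff_add] at *; rw [hp, hq]
  | mul_X p j hp =>
    simp only [taylorPoly, map_mul, aeval_X, Polynomial.mul_coeff_zero] at *
    rw [hp]; simp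

/-- By the chain rule, `k + 1` times the coefficient of `T ^ (k + 1)` is a combination of the `T ^
k` coefficients for the first partial derivatives of `Q`. Induct on `s`, using characteristic zero.
-/
theorem taylorPoly_coeff_eq_zero {N : ℕ} (π z : Fin N → MvPolynomial (Fin N) ℝ) (s : ℕ) :
    ∀ Q : MvPolynomial (Fin N) ℝ,
      (∀ L : List (Fin N), L.length ≤ s → aeval π (iterPderiv L Q) = 0) →
      ∀ k ≤ s, (taylorPoly π z Q).coeff k = 0 := by
  induction s with
  | zero =>
    intro Q h k hk
    obtain rfl : k = 0 := by omega
    rw [taylorPoly_coeff_zero]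
    exact h [] le_rfl
  | succ s ih =>
    intro Q h k hk
    cases k with
    | zero =>
      rw [taylorPoly_coeff_zero]
      exact h [] (by simp)
    | succ k =>
      have h1 := congrArg (fun p => Polynomial.coeff p k) (taylorPoly_derivative π z Q)
      simp only [Polynomial.coeff_derivative, Polynomial.finsetSum_coeff,
        Polynomial.coeff_C_mul] at h1
      rw [Finset.sum_eq_zero] at h1
      · rcases mul_eq_zero.1 h1 with h2 | h2
        · exact h2
        · exact absurd h2 (by exact_mod_cast Nat.succ_ne_zero k)
      · intro j _
        rw [ih (pderiv j Q) (fun L hL => h (j :: L) (by simpa using hL)) k (by omega), mul_zero]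

/-- If all partial derivatives of `Q` of order at most `s` vanish after substituting `π`, then `Q`
lies in the `(s + 1)`-st power of every ideal that contains all `X j - π j`. -/
theorem mem_pow_of_iterPderiv {N : ℕ} (π z : Fin N → MvPolynomial (Fin N) ℝ)
    (h : ∀ j, π j + z j = X j) (I : Ideal (MvPolynomial (Fin N) ℝ)) (hz : ∀ j, z j ∈ I)
    (Q : MvPolynomial (Fin N) ℝ) (s : ℕ)
    (hQ : ∀ L : List (Fin N), L.length ≤ s → aeval π (iterPderiv L Q) = 0) :
    Q ∈ I ^ (s + 1) := by
  rw [← taylorPoly_eval_one π z h Q, Polynomial.eval_eq_sum_range]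
  refine Ideal.sum_mem _ fun k _ => ?_
  rw [one_pow, mul_one]
  by_cases hk : k ≤ s
  · rw [taylorPoly_coeff_eq_zero π z s Q hQ k hk]
    exact Ideal.zero_mem _
  · exact Ideal.pow_le_pow_right (by omega) (taylorPoly_coeff_mem π z I hz Q k)

/-- By the Leibniz rule a derivative costs at most one factor from `I`. -/
theorem pderiv_mem_pow {N : ℕ} (I : Ideal (MvPolynomial (Fin N) ℝ)) (j : Fin N) (k : ℕ)
    {Q : MvPolynomial (Fin N) ℝ} (hQ : Q ∈ I ^ (k + 1)) : pderiv j Q ∈ I ^ k := by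
  induction k generalizing Q with
  | zero => simp
  | succ k ih =>
    rw [pow_succ] at hQ
    induction hQ using Submodule.mul_induction_on' with
    | mem_mul_mem a ha b hb =>
      rw [Derivation.leibniz, smul_eq_mul, smul_eq_mul]
      refine Ideal.add_mem _ (Ideal.mul_mem_right _ _ ha) ?_
      rw [pow_succ, mul_comm b]
      exact Ideal.mul_mem_mul (ih ha) hb
    | add a _ b _ ha hb => rw [map_add]; exact Ideal.add_mem _ ha hb

theorem eval_iterPderiv_eq_zero {N : ℕ} (I : Ideal (MvPolynomial (Fin N) ℝ)) (x : Fin N → ℝ)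
    (hx : ∀ p ∈ I, eval x p = 0) (L : List (Fin N)) :
    ∀ (s : ℕ), L.length ≤ s → ∀ Q ∈ I ^ (s + 1), eval x (iterPderiv L Q) = 0 := by
  induction L with
  | nil => exact fun s _ Q hQ => hx Q (Ideal.pow_le_self (Nat.succ_ne_zero s) hQ)
  | cons j L ih =>
    intro s hs Q hQ
    obtain ⟨s, rfl⟩ : ∃ t, s = t + 1 := ⟨s - 1, by simp at hs; omega⟩
    exact ih s (by simpa using hs) _ (pderiv_mem_pow I j _ hQ)

theorem iterPderiv_sub {N : ℕ} (L : List (Fin N)) (p q : MvPolynomial (Fin N) ℝ) :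
    iterPderiv L (p - q) = iterPderiv L p - iterPderiv L q := by
  rw [eq_sub_iff_add_eq, ← iterPderiv_add, sub_add_cancel]

/-- A polynomial that vanishes at all combinations of the vectors `w v` with small positive
coefficients vanishes on their span. -/
theorem eval_sum_smul_eq_zero {N : ℕ} {ι : Type*} [Fintype ι] (w : ι → Fin N → ℝ) {δ : ℝ}
    (hδ : 0 < δ) (R : MvPolynomial (Fin N) ℝ)
    (h : ∀ c : ι → ℝ, (∀ v, 0 < c v ∧ c v < δ) → eval (∑ v, c v • w v) R = 0) (c : ι → ℝ) :
    eval (∑ v, c v • w v) R = 0 := by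
  have key : ∀ c : ι → ℝ, eval c (aeval (fun j => ∑ v, C (w v j) * X v) R) =
      eval (∑ v, c v • w v) R := by
    intro c
    rw [← coe_aeval_eq_eval, ← coe_aeval_eq_eval, RingHom.coe_coe, RingHom.coe_coe,
      ← AlgHom.comp_apply, comp_aeval]
    congr 2
    funext j
    simp [Finset.sum_apply, mul_comm]
  have h0 : aeval (fun j => ∑ v, C (w v j) * X v) R = (0 : MvPolynomial ι ℝ) := by
    -- As a polynomial in the coefficients `c`, `R` vanishes on a product of infinite sets, hence
    -- identically.
    refine funext_set (fun _ => Set.Ioo 0 δ) (fun _ => Set.Ioo_infinite hδ) fun c hc => ?_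
    rw [key, map_zero]
    exact h c fun v => hc v trivial
  rw [← key, h0, map_zero]

/-! ### Linear forms -/

/-- The linear form with the values of the functional `φ`. -/
noncomputable def linForm {N : ℕ} (φ : (Fin N → ℝ) →ₗ[ℝ] ℝ) : MvPolynomial (Fin N) ℝ :=
  ∑ j, C (φ (Pi.single j 1)) * X j

theorem eval_linForm {N : ℕ} (φ : (Fin N → ℝ) →ₗ[ℝ] ℝ) (x : Fin N → ℝ) :
    eval x (linForm φ) = φ x := by
  conv_rhs => rw [pi_eq_sum_univ' x]
  simp [linForm, mul_comm]

theorem exists_linForm_of_isHomogeneous {N : ℕ} {p : MvPolynomial (Fin N) ℝ}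
    (hp : p.IsHomogeneous 1) : ∃ φ, p = linForm φ := by
  have h : p ∈ MvPolynomial.homogeneousSubmodule (Fin N) ℝ 1 := hp
  rw [homogeneousSubmodule_one_eq_span_X, Submodule.mem_span_range_iff_exists_fun] at h
  obtain ⟨c, rfl⟩ := h
  refine ⟨Fintype.linearCombination ℝ c, ?_⟩
  simp [linForm, smul_eq_C_mul, Fintype.linearCombination_apply_single]

/-! ### Homogenization and linear forms in the ideal of a face -/

theorem eval_homogenization {n : ℕ} (p : MvPolynomial (Fin n) ℝ) (t : ℝ)
    (y : Fin n → ℝ) :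
    eval (t • lift y) (homogenization p) = t ^ p.totalDegree * eval y p := by
  rw [homogenization, map_sum, eval_eq', Finset.mul_sum]
  refine Finset.sum_congr rfl fun m hm => ?_
  -- This makes the truncated subtraction in the exponent of `X 0` an honest one.
  have hd : m.degree ≤ p.totalDegree := by
    rw [Finsupp.degree_eq_sum, ← Finsupp.sum_fintype m (fun _ e => e) (fun _ => rfl)]
    exact le_totalDegree hm
  rw [eval_monomial, Finsupp.prod_fintype _ _ (fun _ => pow_zero _), Fin.prod_univ_succ]
  simp only [Finsupp.cons_zero, Finsupp.cons_succ, Pi.smul_apply, smul_eq_mul, lift,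
    Function.Embedding.coeFn_mk, Fin.cons_zero, Fin.cons_succ, mul_one, mul_pow,
    Finset.prod_mul_distrib, Finset.prod_pow_eq_pow_sum]
  rw [← Finsupp.degree_eq_sum, ← mul_assoc (t ^ _), ← pow_add, Nat.sub_add_cancel hd]
  ring

/-- Setting `x₀ = 1` turns the form into a polynomial `p` of degree at most one that vanishes on
`β`. If the degree is one, homogenizing recovers the form. If `p` is constant, it is zero because it
vanishes at a vertex, and the form is zero as well. -/
theorem linForm_mem_homVanishingIdeal {n : ℕ} {β : Finset (Fin n → ℝ)} (hβ : β.Nonempty)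
    (φ : (Fin (n + 1) → ℝ) →ₗ[ℝ] ℝ) (h : ∀ v ∈ β, φ (lift v) = 0) :
    linForm φ ∈ homVanishingIdeal β := by
  set p : MvPolynomial (Fin n) ℝ :=
    C (φ (Pi.single 0 1)) + ∑ j : Fin n, C (φ (Pi.single j.succ 1)) * X j with hp
  have hev : ∀ y, eval y p = φ (lift y) := by
    intro y
    rw [← eval_linForm, linForm, Fin.sum_univ_succ]
    simp [hp, lift]
  have hdeg : p.totalDegree ≤ 1 := by
    refine (totalDegree_add _ _).trans (max_le (by simp) ?_)
    refine totalDegree_finsetSum_le fun j _ => (totalDegree_mul _ _).trans ?_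
    simp
  have hvan : ∀ y ∈ convexHull ℝ (β : Set (Fin n → ℝ)), φ (lift y) = 0 := by
    intro y hy
    have : convexHull ℝ (β : Set (Fin n → ℝ)) ⊆
        {y | (φ.toAffineMap.comp (liftAffine n)) y ∈ ({0} : Set ℝ)} :=
      convexHull_min (fun v hv => h v hv)
        ((convex_singleton (𝕜 := ℝ) (0 : ℝ)).affine_preimage (φ.toAffineMap.comp (liftAffine n)))
    exact this hy
  have hmem : p ∈ MvPolynomial.vanishingIdeal ℝ (convexHull ℝ (β : Set (Fin n → ℝ))) := by
    rw [mem_vanishingIdeal_iff]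
    intro y hy
    have h0 := (hev y).trans (hvan y hy)
    rwa [← coe_aeval_eq_eval] at h0
  have agree : ∀ q : MvPolynomial (Fin (n + 1)) ℝ,
      (∀ (t : ℝ) (y : Fin n → ℝ), eval (t • lift y) q = φ (t • lift y)) → linForm φ = q := by
    intro q hq
    -- Polynomials are compared only where `x₀ ≠ 0`; there every point is a multiple of a lifted
    -- point.
    refine funext_set (Fin.cons {0}ᶜ fun _ => Set.univ) (fun j => ?_) fun x hx => ?_
    · refine Fin.cases ?_ (fun j => ?_) j
      · simpa using (Set.finite_singleton (0 : ℝ)).infinite_compl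
      · simpa using Set.infinite_univ
    · have hx0 : x 0 ≠ 0 := by simpa using hx 0 trivial
      have ex : x = x 0 • lift (fun j => (x 0)⁻¹ * x j.succ) := by
        funext j
        refine Fin.cases ?_ (fun j => ?_) j
        · simp [lift]
        · simp [lift, hx0]
      rw [eval_linForm, ex, hq]
  by_cases hd : p.totalDegree = 1
  · have e : linForm φ = homogenization p := agree _ fun t y => by
      rw [eval_homogenization p t, hd, pow_one, hev, map_smul, smul_eq_mul]
    rw [e]
    exact Ideal.subset_span ⟨p, hmem, rfl⟩
  · have h0 : p.totalDegree = 0 := by omega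
    rw [totalDegree_eq_zero_iff_eq_C] at h0
    obtain ⟨v, hv⟩ := hβ
    have hc : coeff 0 p = 0 := by
      have := hev v
      rw [h v hv, h0] at this
      simpa using this
    rw [hc, C_0] at h0
    rw [agree 0 fun t y => by rw [map_smul, ← hev, h0]; simp]
    exact Ideal.zero_mem _

/-! ### Coordinates with respect to a top-dimensional face -/

theorem linearIndependent_lift {n : ℕ} {σ : Finset (Fin n → ℝ)}
    (h : AffineIndependent ℝ ((↑) : σ → Fin n → ℝ)) :
    LinearIndependent ℝ (fun x : σ => lift x.1) := by
  rw [linearIndependent_iff']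
  intro t g hg
  refine (affineIndependent_iff.1 h) t g ?_ ?_
  · have := congrFun hg 0
    simpa [lift, Finset.sum_apply] using this
  · funext j
    have := congrFun hg j.succ
    simpa [lift, Finset.sum_apply] using this

/-- The basis of `ℝⁿ⁺¹` given by the lifted vertices of an `n`-face. -/
noncomputable def coneBasis {n : ℕ} {K : Complex n} {σ : Finset (Fin n → ℝ)}
    (hσ : σ ∈ facesOfDim K n) : Module.Basis σ ℝ (Fin (n + 1) → ℝ) :=
  haveI : Nonempty σ := (K.nonempty_of_mem_faces hσ.1).to_subtype
  basisOfLinearIndependentOfCardEqFinrank (linearIndependent_lift (K.indep hσ.1))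
    (by simp [hσ.2])

theorem coneBasis_apply {n : ℕ} {K : Complex n} {σ : Finset (Fin n → ℝ)}
    (hσ : σ ∈ facesOfDim K n) (v : σ) : coneBasis hσ v = lift v.1 := by
  simp [coneBasis]

open Classical in
/-- The coordinate of the lifted vertex `v` of the `n`-face `σ` (zero if `v` is no vertex). -/
noncomputable def coneCoord {n : ℕ} {K : Complex n} {σ : Finset (Fin n → ℝ)}
    (hσ : σ ∈ facesOfDim K n) (v : Fin n → ℝ) : (Fin (n + 1) → ℝ) →ₗ[ℝ] ℝ :=
  if h : v ∈ σ then (coneBasis hσ).coord ⟨v, h⟩ else 0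

open Classical in
theorem coneCoord_lift {n : ℕ} {K : Complex n} {σ : Finset (Fin n → ℝ)}
    (hσ : σ ∈ facesOfDim K n) (v : Fin n → ℝ) {w : Fin n → ℝ} (hw : w ∈ σ) :
    coneCoord hσ v (lift w) = if w = v then 1 else 0 := by
  unfold coneCoord
  split_ifs with h e e
  · subst e
    rw [← coneBasis_apply hσ ⟨w, hw⟩]; simp
  · rw [← coneBasis_apply hσ ⟨w, hw⟩]
    simp [e]
  · exact absurd (e ▸ hw) h
  · simp

theorem sum_coneCoord {n : ℕ} {K : Complex n} {σ : Finset (Fin n → ℝ)}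
    (hσ : σ ∈ facesOfDim K n) (x : Fin (n + 1) → ℝ) :
    ∑ v ∈ σ, coneCoord hσ v x • lift v = x := by
  conv_rhs => rw [← (coneBasis hσ).sum_repr x]
  rw [← Finset.sum_coe_sort]
  refine Finset.sum_congr rfl fun v _ => ?_
  rw [coneBasis_apply, coneCoord, dif_pos v.2]; simp

open Classical in
theorem coneCoord_sum {n : ℕ} {K : Complex n} {σ β : Finset (Fin n → ℝ)}
    (hσ : σ ∈ facesOfDim K n) (hβ : β ⊆ σ) (c : (Fin n → ℝ) → ℝ) (v : Fin n → ℝ) :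
    coneCoord hσ v (∑ w ∈ β, c w • lift w) = if v ∈ β then c v else 0 := by
  rw [map_sum]
  rw [Finset.sum_congr rfl fun w hw => by rw [map_smul, coneCoord_lift hσ v (hβ hw)]]
  simp

theorem sum_smul_lift_zero {n : ℕ} (β : Finset (Fin n → ℝ)) (c : (Fin n → ℝ) → ℝ) :
    (∑ w ∈ β, c w • lift w) 0 = ∑ w ∈ β, c w := by
  rw [sum_lift_eq]; simp

theorem lift_mem_coneFace {n : ℕ} {β : Finset (Fin n → ℝ)} {v : Fin n → ℝ} :
    lift v ∈ coneFace β ↔ v ∈ β := by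
  rw [mem_coneFace]
  constructor
  · rintro (h | ⟨x, hx, h⟩)
    · have := congrFun h 0
      simp [lift] at this
    · exact lift.injective h ▸ hx
  · exact fun h => Or.inr ⟨v, h, rfl⟩

theorem sum_mem_hull {n : ℕ} (β : Finset (Fin n → ℝ)) (c : (Fin n → ℝ) → ℝ)
    (h0 : ∀ v ∈ β, 0 ≤ c v) (h1 : ∑ v ∈ β, c v ≤ 1) :
    ∑ v ∈ β, c v • lift v ∈ convexHull ℝ (coneFace β : Set (Fin (n + 1) → ℝ)) := by
  have h := (convex_convexHull ℝ (coneFace β : Set (Fin (n + 1) → ℝ))).sum_mem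
    (t := Finset.univ) (w := fun o : Option β => o.elim (1 - ∑ v ∈ β, c v) fun v => c v)
    (z := fun o : Option β => o.elim 0 fun v => lift v.1) ?_ ?_ ?_
  · rw [Fintype.sum_option] at h
    simpa [Finset.sum_attach β fun v => c v • lift v] using h
  · rintro (_ | v) -
    · simpa using h1
    · exact h0 v v.2
  · rw [Fintype.sum_option]
    simp [Finset.sum_attach β c]
  · rintro (_ | v) -
    · exact subset_convexHull ℝ _ (mem_coneFace.2 (Or.inl rfl))
    · exact subset_convexHull ℝ _ (lift_mem_coneFace.2 v.2)

theorem nonneg_of_mem_hull {N : ℕ} (φ : (Fin N → ℝ) →ₗ[ℝ] ℝ) {s : Set (Fin N → ℝ)}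
    (h : ∀ v ∈ s, 0 ≤ φ v) {x : Fin N → ℝ} (hx : x ∈ convexHull ℝ s) : 0 ≤ φ x :=
  convexHull_min (t := {x | 0 ≤ φ x}) h (convex_halfSpace_ge φ.isLinear 0) hx

theorem eq_zero_of_mem_hull {N : ℕ} (φ : (Fin N → ℝ) →ₗ[ℝ] ℝ) {s : Set (Fin N → ℝ)}
    (h : ∀ v ∈ s, φ v = 0) {x : Fin N → ℝ} (hx : x ∈ convexHull ℝ s) : φ x = 0 :=
  convexHull_min (t := {x | φ x = 0}) h (convex_hyperplane φ.isLinear 0) hx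

theorem coneCoord_nonneg {n : ℕ} {K : Complex n} {σ : Finset (Fin n → ℝ)}
    (hσ : σ ∈ facesOfDim K n) (v : Fin n → ℝ) {x : Fin (n + 1) → ℝ}
    (hx : x ∈ convexHull ℝ (coneFace σ : Set (Fin (n + 1) → ℝ))) : 0 ≤ coneCoord hσ v x := by
  classical
  refine nonneg_of_mem_hull _ (fun z hz => ?_) hx
  rcases mem_coneFace.1 hz with rfl | ⟨w, hw, rfl⟩
  · simp
  · rw [coneCoord_lift hσ v hw]; split_ifs <;> norm_num

theorem sum_coneCoord_eq {n : ℕ} {K : Complex n} {σ : Finset (Fin n → ℝ)}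
    (hσ : σ ∈ facesOfDim K n) (x : Fin (n + 1) → ℝ) : ∑ v ∈ σ, coneCoord hσ v x = x 0 := by
  conv_rhs => rw [← sum_coneCoord hσ x]
  rw [sum_smul_lift_zero σ fun v => coneCoord hσ v x]

theorem mem_hull_of_coneCoord {n : ℕ} {K : Complex n} {σ : Finset (Fin n → ℝ)}
    (hσ : σ ∈ facesOfDim K n) {x : Fin (n + 1) → ℝ} (h : ∀ v ∈ σ, 0 ≤ coneCoord hσ v x)
    (h1 : x 0 ≤ 1) : x ∈ convexHull ℝ (coneFace σ : Set (Fin (n + 1) → ℝ)) := by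
  have := sum_mem_hull σ (fun v => coneCoord hσ v x) h (by rwa [sum_coneCoord_eq])
  rwa [sum_coneCoord] at this

/-- Polynomials that agree on the cone over an `n`-face are equal. -/
theorem eq_of_eval_eq_on_coneFace {n : ℕ} {K : Complex n} {σ : Finset (Fin n → ℝ)}
    (hσ : σ ∈ facesOfDim K n) {p q : PolyRing n}
    (h : ∀ x ∈ convexHull ℝ (coneFace σ : Set (Fin (n + 1) → ℝ)), eval x p = eval x q) :
    p = q := by
  rw [← sub_eq_zero]
  refine MvPolynomial.funext fun x => ?_
  -- With `n + 1` coefficients below `1 / (n + 1)` the sum stays at most `1`, so the combination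
  -- remains in the cone, which is truncated at height one.
  have key := eval_sum_smul_eq_zero (fun v : σ => lift v.1) (δ := 1 / (n + 1)) (by positivity)
    (p - q) (fun c hc => ?_) (fun v => coneCoord hσ v.1 x)
  · rw [Finset.sum_coe_sort σ fun v => coneCoord hσ v x • lift v, sum_coneCoord] at key
    rw [key, map_zero]
  · classical
    rw [map_sub, sub_eq_zero]
    apply h
    set d : (Fin n → ℝ) → ℝ := fun v => if hv : v ∈ σ then c ⟨v, hv⟩ else 0
    have hd : ∀ v : σ, c v = d v := fun v => by simp [d]
    simp only [hd] at hc ⊢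
    rw [Finset.sum_coe_sort σ fun v => d v • lift v]
    refine sum_mem_hull σ d (fun v hv => (hc ⟨v, hv⟩).1.le) ?_
    refine (Finset.sum_le_card_nsmul σ d (1 / (n + 1)) fun v hv => (hc ⟨v, hv⟩).2.le).trans ?_
    rw [hσ.2, nsmul_eq_mul]; push_cast; field_simp; exact le_rfl

/-! ### Two `n`-faces with a common codimension one face -/

theorem insert_eq_of_card {α : Type*} [DecidableEq α] {τ σ : Finset α} {v : α} (h : τ ⊆ σ)
    (hv : v ∈ σ) (hvτ : v ∉ τ) (hc : σ.card = τ.card + 1) : insert v τ = σ :=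
  Finset.eq_of_subset_of_card_le (Finset.insert_subset hv h)
    (by rw [Finset.card_insert_of_notMem hvτ, hc])

/-- Only the vertex `v` of `σ` is missing from `τ`, so a functional killing the lifted vertices of
`τ` is determined by its value at the lift of `v`. -/
theorem eq_mul_coneCoord {n : ℕ} {K : Complex n} {σ τ : Finset (Fin n → ℝ)}
    (hσ : σ ∈ facesOfDim K n) (hτ : τ ⊆ σ) (hc : τ.card = n) {v : Fin n → ℝ} (hv : v ∈ σ)
    (hvτ : v ∉ τ) (φ : (Fin (n + 1) → ℝ) →ₗ[ℝ] ℝ) (hφ : ∀ w ∈ τ, φ (lift w) = 0)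
    (x : Fin (n + 1) → ℝ) : φ x = φ (lift v) * coneCoord hσ v x := by
  classical
  conv_lhs => rw [← sum_coneCoord hσ x]
  rw [map_sum, Finset.sum_eq_single v, map_smul, smul_eq_mul, mul_comm]
  · intro w hw hwv
    rw [← insert_eq_of_card hτ hv hvτ (by rw [hσ.2, hc])] at hw
    rw [map_smul, hφ w (Finset.mem_of_mem_insert_of_ne hw hwv), smul_zero]
  · exact fun h => absurd hv h

theorem mem_hull_inter_coneFace {n : ℕ} (K : Complex n) {σ σ' : Finset (Fin n → ℝ)}
    (hσ : σ ∈ K.faces) (hσ' : σ' ∈ K.faces) {x : Fin (n + 1) → ℝ}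
    (hx : x ∈ convexHull ℝ (coneFace σ : Set (Fin (n + 1) → ℝ)))
    (hx' : x ∈ convexHull ℝ (coneFace σ' : Set (Fin (n + 1) → ℝ))) :
    x ∈ convexHull ℝ ((coneFace σ : Set (Fin (n + 1) → ℝ)) ∩ coneFace σ') :=
  (cone K).inter_subset_convexHull ⟨σ, Or.inl ⟨hσ, Or.inl rfl⟩⟩
    ⟨σ', Or.inl ⟨hσ', Or.inl rfl⟩⟩ ⟨hx, hx'⟩

/-- Distinct `n`-faces sharing `τ` lie on opposite sides of it. Otherwise, adding a large multiple
of the vertices of `τ` to `v'` and rescaling gives a point of both cones. Such a point lies in the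
hull of the common vertices, where the coordinate of `v'` is zero; but it is positive by
construction. -/
theorem coneCoord_neg {n : ℕ} {K : Complex n} {σ σ' τ : Finset (Fin n → ℝ)}
    (hσ : σ ∈ facesOfDim K n) (hσ' : σ' ∈ facesOfDim K n) (hne : σ ≠ σ') (hτ : τ ⊆ σ)
    (hτ' : τ ⊆ σ') (hc : τ.card = n) {v v' : Fin n → ℝ} (hv : v ∈ σ) (hvτ : v ∉ τ)
    (hv' : v' ∈ σ') (hvτ' : v' ∉ τ) : coneCoord hσ v (lift v') < 0 := by
  classical
  by_contra! ha
  have hi := insert_eq_of_card hτ hv hvτ (by rw [hσ.2, hc])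
  have hi' := insert_eq_of_card hτ' hv' hvτ' (by rw [hσ'.2, hc])
  have hv'σ : v' ∉ σ := fun h =>
    hne ((insert_eq_of_card hτ h hvτ' (by rw [hσ.2, hc])).symm.trans hi')
  -- `M` dominates each `σ`-coordinate of the lift of `v'` at a vertex of `τ`, so adding `M` makes
  -- all these coordinates nonnegative.
  set M : ℝ := ∑ w ∈ τ, |coneCoord hσ w (lift v')| with hM
  have hM0 : 0 ≤ M := Finset.sum_nonneg fun w _ => abs_nonneg _
  set d : (Fin n → ℝ) → ℝ := fun w => if w = v' then 1 else M with hd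
  set y : Fin (n + 1) → ℝ := ∑ w ∈ σ', d w • lift w with hy
  have hd0 : ∀ w ∈ σ', 0 ≤ d w := fun w _ => by simp only [hd]; split_ifs <;> linarith
  have hy0 : y 0 = ∑ w ∈ σ', d w := sum_smul_lift_zero σ' d
  have hy1 : 1 ≤ y 0 := by
    rw [hy0]
    refine le_trans ?_ (Finset.single_le_sum hd0 hv')
    simp [hd]
  have hypos : 0 < y 0 := by linarith
  -- Dividing by `y 0` brings the point to height one, where the truncated cone ends.
  have hx' : (y 0)⁻¹ • y ∈ convexHull ℝ (coneFace σ' : Set (Fin (n + 1) → ℝ)) := by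
    refine mem_hull_of_coneCoord hσ' (fun w hw => ?_) ?_
    · rw [map_smul, smul_eq_mul, coneCoord_sum hσ' subset_rfl, if_pos hw]
      exact mul_nonneg (inv_nonneg.2 hypos.le) (hd0 w hw)
    · rw [Pi.smul_apply, smul_eq_mul, inv_mul_cancel₀ hypos.ne']
  have ey : y = (∑ w ∈ τ, M • lift w) + lift v' := by
    rw [hy, ← hi', Finset.sum_insert hvτ', add_comm (d v' • lift v')]
    congr 1
    · refine Finset.sum_congr rfl fun w hw => ?_
      rw [hd]; simp only; rw [if_neg]; rintro rfl; exact hvτ' hw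
    · simp [hd]
  have hx : (y 0)⁻¹ • y ∈ convexHull ℝ (coneFace σ : Set (Fin (n + 1) → ℝ)) := by
    refine mem_hull_of_coneCoord hσ (fun w hw => ?_) ?_
    · rw [map_smul, smul_eq_mul]
      refine mul_nonneg (inv_nonneg.2 hypos.le) ?_
      rw [ey, map_add, coneCoord_sum hσ hτ fun _ => M]
      rw [← hi, Finset.mem_insert] at hw
      rcases hw with rfl | hw
      · rw [if_neg hvτ, zero_add]; exact ha
      · rw [if_pos hw]
        have h1 := Finset.single_le_sum (f := fun w => |coneCoord hσ w (lift v')|)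
          (fun w _ => abs_nonneg _) hw
        have h2 := neg_abs_le (coneCoord hσ w (lift v'))
        linarith
    · rw [Pi.smul_apply, smul_eq_mul, inv_mul_cancel₀ hypos.ne']
  have h0 : coneCoord hσ' v' ((y 0)⁻¹ • y) = 0 := by
    refine eq_zero_of_mem_hull _ (fun z hz => ?_) (mem_hull_inter_coneFace K hσ.1 hσ'.1 hx hx')
    obtain ⟨hz, hz'⟩ := hz
    rcases mem_coneFace.1 hz' with rfl | ⟨w, hw, rfl⟩
    · simp
    · rw [coneCoord_lift hσ' v' hw, if_neg]
      rintro rfl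
      exact hv'σ (lift_mem_coneFace.1 hz)
  rw [map_smul, coneCoord_sum hσ' subset_rfl, if_pos hv', smul_eq_mul] at h0
  have : (y 0)⁻¹ ≠ 0 := inv_ne_zero hypos.ne'
  simp [hd, hypos.ne'] at h0

theorem exists_mem_notMem_of_facet {n : ℕ} {K : Complex n} {σ τ : Finset (Fin n → ℝ)}
    (hσ : σ ∈ facesOfDim K n) (hc : τ.card = n) : ∃ v ∈ σ, v ∉ τ := by
  by_contra! h
  have := Finset.card_le_card (show σ ⊆ τ from h)
  have := hσ.2
  omega

/-- There are only two sides of `τ`: if `v'` and `v''` were both opposite to `v`, and also opposite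
to each other, the product of two negative coordinates would be negative. -/
theorem eq_of_three_faces {n : ℕ} {K : Complex n} {σ σ' σ'' τ : Finset (Fin n → ℝ)}
    (hσ : σ ∈ facesOfDim K n) (hσ' : σ' ∈ facesOfDim K n) (hσ'' : σ'' ∈ facesOfDim K n)
    (hτ : τ ⊆ σ) (hτ' : τ ⊆ σ') (hτ'' : τ ⊆ σ'') (hc : τ.card = n) (h' : σ ≠ σ') (h'' : σ ≠ σ'') :
    σ' = σ'' := by
  by_contra hne
  obtain ⟨v, hv, hvτ⟩ := exists_mem_notMem_of_facet hσ hc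
  obtain ⟨v', hv', hvτ'⟩ := exists_mem_notMem_of_facet hσ' hc
  obtain ⟨v'', hv'', hvτ''⟩ := exists_mem_notMem_of_facet hσ'' hc
  have h1 := coneCoord_neg hσ hσ' h' hτ hτ' hc hv hvτ hv' hvτ'
  have h2 := coneCoord_neg hσ hσ'' h'' hτ hτ'' hc hv hvτ hv'' hvτ''
  have h3 := coneCoord_neg hσ' hσ'' hne hτ' hτ'' hc hv' hvτ' hv'' hvτ''
  have h4 := eq_mul_coneCoord hσ' hτ' hc hv' hvτ' (coneCoord hσ v) (fun w hw => by
    rw [coneCoord_lift hσ v (hτ hw), if_neg]; rintro rfl; exact hvτ hw) (lift v'')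
  nlinarith [mul_pos_of_neg_of_neg h1 h3]

theorem exists_facet_of_face {n : ℕ} {K : Complex n} (hfin : K.faces.Finite) (hpure : IsPure K)
    {τ : Finset (Fin n → ℝ)} (hτ : τ ∈ K.faces) : ∃ σ ∈ facesOfDim K n, τ ⊆ σ := by
  obtain ⟨σ, hτσ, hσ⟩ := hfin.exists_le_maximal hτ
  exact ⟨σ, hpure σ ⟨hσ.1, fun t ht h => subset_antisymm h (hσ.2 ht h)⟩, hτσ⟩

theorem exists_two_faces {n : ℕ} (hn : 1 ≤ n) {K : Complex n} (hfin : K.faces.Finite)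
    (hpure : IsPure K) {τ : Finset (Fin n → ℝ)} (hτ : τ ∈ interiorFaces K (n - 1)) :
    ∃ σ ∈ facesOfDim K n, ∃ σ' ∈ facesOfDim K n, τ ⊆ σ ∧ τ ⊆ σ' ∧ σ ≠ σ' := by
  obtain ⟨σ, hσ, hτσ⟩ := exists_facet_of_face hfin hpure hτ.1.1
  by_contra! h
  -- If `σ` were the only `n`-face on `τ`, then `τ` itself would witness that `τ` is a boundary
  -- face.
  refine hτ.2 ⟨τ, hτ.1.1, ?_, subset_rfl, σ, ⟨hσ, hτσ⟩, fun σ' hσ' => ?_⟩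
  · have := hτ.1.2; omega
  · exact (h σ hσ σ' hσ'.1 hτσ hσ'.2).symm

/-! ### The faces of the cone -/

theorem coneFace_injective {n : ℕ} : Function.Injective (coneFace (n := n)) := fun σ σ' h => by
  rw [← baseFace_coneFace σ, h, baseFace_coneFace]

theorem coneFace_subset {n : ℕ} {σ σ' : Finset (Fin n → ℝ)} :
    coneFace σ ⊆ coneFace σ' ↔ σ ⊆ σ' := by
  constructor
  · intro h x hx
    exact lift_mem_coneFace.1 (h (lift_mem_coneFace.2 hx))
  · intro h z hz
    rcases mem_coneFace.1 hz with rfl | ⟨x, hx, rfl⟩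
    · exact mem_coneFace.2 (Or.inl rfl)
    · exact lift_mem_coneFace.2 (h hx)

theorem card_coneFace {n : ℕ} (σ : Finset (Fin n → ℝ)) : (coneFace σ).card = σ.card + 1 := by
  rw [coneFace, Finset.card_cons, Finset.card_map]

theorem card_le_of_mem_faces {n : ℕ} {K : Complex n} {σ : Finset (Fin n → ℝ)}
    (hσ : σ ∈ K.faces) : σ.card ≤ n + 1 := by
  have := (linearIndependent_lift (K.indep hσ)).fintype_card_le_finrank
  simpa using this

/-- Lifted faces have at most `n + 1` vertices, one fewer than a top-dimensional face of the cone.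
-/
theorem facesOfDim_cone {n : ℕ} (K : Complex n) :
    facesOfDim (cone K) (n + 1) = coneFace '' facesOfDim K n := by
  ext t
  constructor
  · rintro ⟨⟨σ, ⟨hσ, rfl | rfl⟩ | ⟨rfl, rfl⟩⟩, hc⟩
    · exact ⟨σ, ⟨hσ, by rw [card_coneFace] at hc; omega⟩, rfl⟩
    · rw [Finset.card_map] at hc
      have := card_le_of_mem_faces hσ
      omega
    · simp [card_coneFace] at hc
  · rintro ⟨σ, hσ, rfl⟩
    exact ⟨⟨σ, Or.inl ⟨hσ.1, Or.inl rfl⟩⟩, by rw [card_coneFace, hσ.2]⟩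

theorem interiorFaces_cone {n : ℕ} (hn : 1 ≤ n) (K : Complex n) :
    interiorFaces (cone K) n = coneFace '' interiorFaces K (n - 1) := by
  have hex : ∀ τ : Finset (Fin n → ℝ),
      (∃! t, t ∈ facesOfDim (cone K) (n + 1) ∧ coneFace τ ⊆ t) ↔
        ∃! σ, σ ∈ facesOfDim K n ∧ τ ⊆ σ := by
    intro τ
    rw [facesOfDim_cone]
    constructor
    · rintro ⟨_, ⟨⟨σ, hσ, rfl⟩, h⟩, hu⟩
      exact ⟨σ, ⟨hσ, coneFace_subset.1 h⟩, fun σ' h' =>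
        coneFace_injective (hu _ ⟨⟨σ', h'.1, rfl⟩, coneFace_subset.2 h'.2⟩)⟩
    · rintro ⟨σ, ⟨hσ, h⟩, hu⟩
      refine ⟨_, ⟨⟨σ, hσ, rfl⟩, coneFace_subset.2 h⟩, ?_⟩
      rintro _ ⟨⟨σ', hσ', rfl⟩, h'⟩
      rw [hu σ' ⟨hσ', coneFace_subset.1 h'⟩]
  ext t
  constructor
  · rintro ⟨⟨⟨σ, ⟨hσ, rfl | rfl⟩ | ⟨rfl, rfl⟩⟩, hc⟩, hb⟩
    · rw [card_coneFace] at hc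
      refine ⟨σ, ⟨⟨hσ, by omega⟩, ?_⟩, rfl⟩
      rintro ⟨τ, hτ, hcτ, hs, hu⟩
      exact hb ⟨coneFace τ, ⟨τ, Or.inl ⟨hτ, Or.inl rfl⟩⟩, by rw [card_coneFace, hcτ],
        coneFace_subset.2 hs, (hex τ).2 hu⟩
    · rw [Finset.card_map] at hc
      -- A lifted `n`-face also has codimension one in the cone, but only the cone over it contains
      -- it, so it is a boundary face.
      refine absurd ⟨σ.map lift, ⟨σ, Or.inl ⟨hσ, Or.inr rfl⟩⟩, by rw [Finset.card_map, hc],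
        subset_rfl, ?_⟩ hb
      rw [facesOfDim_cone]
      refine ⟨coneFace σ, ⟨⟨σ, ⟨hσ, hc⟩, rfl⟩, Finset.subset_cons _⟩, ?_⟩
      rintro _ ⟨⟨σ', hσ', rfl⟩, h'⟩
      have hs : σ ⊆ σ' := fun x hx =>
        lift_mem_coneFace.1 (h' (Finset.mem_map_of_mem lift hx))
      rw [Finset.eq_of_subset_of_card_le hs (by rw [hσ'.2, hc])]
    · simp [card_coneFace] at hc; omega
  · rintro ⟨τ, hτ, rfl⟩
    have hcτ : τ.card = n := by have := hτ.1.2; omega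
    refine ⟨⟨⟨τ, Or.inl ⟨hτ.1.1, Or.inl rfl⟩⟩, by rw [card_coneFace, hcτ]⟩, ?_⟩
    rintro ⟨t, ht, hct, hs, hu⟩
    obtain rfl := Finset.eq_of_subset_of_card_le hs (by rw [hct, card_coneFace, hcτ])
    exact hτ.2 ⟨τ, hτ.1.1, hcτ, subset_rfl, (hex τ).1 hu⟩

/-! ### Ideals of faces and vanishing of derivatives -/

/-- The coordinate forms of the vertices of `σ` outside `β` generate an ideal whose powers contain
the polynomials vanishing to the corresponding order on the cone over `β`. -/
theorem mem_pow_of_eval_iterPderiv {n : ℕ} {K : Complex n} {σ β : Finset (Fin n → ℝ)}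
    (hσ : σ ∈ facesOfDim K n) (hβ : β ⊆ σ) (I : Ideal (PolyRing n))
    (hI : ∀ v ∈ σ, v ∉ β → linForm (coneCoord hσ v) ∈ I) {δ : ℝ} (hδ : 0 < δ) (s : ℕ)
    (Q : PolyRing n)
    (hQ : ∀ L : List (Fin (n + 1)), L.length ≤ s → ∀ c : (Fin n → ℝ) → ℝ,
      (∀ v ∈ β, 0 < c v ∧ c v < δ) → eval (∑ v ∈ β, c v • lift v) (iterPderiv L Q) = 0) :
    Q ∈ I ^ (s + 1) := by
  classical
  refine mem_pow_of_iterPderiv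
    -- `π` is the projection onto the span of the lifted vertices of `β` along those of the other
    -- vertices of `σ`; `z` is the complementary projection, whose components lie in `I`.
    (fun j => ∑ v ∈ β, C (lift v j) * linForm (coneCoord hσ v))
    (fun j => ∑ v ∈ σ \ β, C (lift v j) * linForm (coneCoord hσ v))
    (fun j => ?_) I (fun j => ?_) Q s (fun L hL => ?_)
  · rw [add_comm (∑ v ∈ β, _), Finset.sum_sdiff hβ]
    refine MvPolynomial.funext fun x => ?_
    have h := congrFun (sum_coneCoord hσ x) j
    rw [Finset.sum_apply] at h
    simpa [eval_linForm, mul_comm] using h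
  · refine Ideal.sum_mem _ fun v hv => Ideal.mul_mem_left _ _ ?_
    rw [Finset.mem_sdiff] at hv
    exact hI v hv.1 hv.2
  · refine MvPolynomial.funext fun x => ?_
    have e : eval x (aeval (fun j => ∑ v ∈ β, C (lift v j) * linForm (coneCoord hσ v))
        (iterPderiv L Q)) = eval (∑ v ∈ β, coneCoord hσ v x • lift v) (iterPderiv L Q) := by
      rw [← coe_aeval_eq_eval, ← coe_aeval_eq_eval, RingHom.coe_coe, RingHom.coe_coe,
        ← AlgHom.comp_apply, comp_aeval]
      congr 2
      funext j
      rw [Finset.sum_apply]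
      simp only [map_sum, map_mul, aeval_C]
      refine Finset.sum_congr rfl fun v _ => ?_
      have := eval_linForm (coneCoord hσ v) x
      rw [← coe_aeval_eq_eval, RingHom.coe_coe] at this
      rw [this]; simp [mul_comm]
    rw [e, map_zero]
    have key := eval_sum_smul_eq_zero (fun v : β => lift v.1) hδ (iterPderiv L Q)
      (fun c hc => ?_) (fun v => coneCoord hσ v.1 x)
    · rwa [Finset.sum_coe_sort β fun v => coneCoord hσ v x • lift v] at key
    · set d : (Fin n → ℝ) → ℝ := fun v => if hv : v ∈ β then c ⟨v, hv⟩ else 0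
      have hd : ∀ v : β, c v = d v := fun v => by simp [d]
      simp only [hd] at hc ⊢
      rw [Finset.sum_coe_sort β fun v => d v • lift v]
      exact hQ L hL d fun v hv => hc ⟨v, hv⟩

theorem sum_le_one_of_lt {n : ℕ} {β : Finset (Fin n → ℝ)} (hβ : β.card ≤ n + 1)
    {c : (Fin n → ℝ) → ℝ} (hc : ∀ v ∈ β, 0 < c v ∧ c v < 1 / (n + 1)) : ∑ v ∈ β, c v ≤ 1 := by
  refine (Finset.sum_le_card_nsmul β c (1 / (n + 1)) fun v hv => (hc v hv).2.le).trans ?_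
  rw [nsmul_eq_mul]
  have : (β.card : ℝ) ≤ n + 1 := by exact_mod_cast hβ
  rw [mul_one_div, div_le_one (by positivity)]
  exact this

/-- At `t • lift y` a homogenization takes the value `t ^ d * p(y)`, where `p(y) = 0`. Using the
second factor also covers the apex `t = 0` when `d = 0`; there any vertex of `β` serves as `y`. -/
theorem eval_eq_zero_of_mem_homVanishingIdeal {n : ℕ} {β : Finset (Fin n → ℝ)}
    (hβ : β.Nonempty) {x : Fin (n + 1) → ℝ}
    (hx : x ∈ convexHull ℝ (coneFace β : Set (Fin (n + 1) → ℝ))) :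
    ∀ p ∈ homVanishingIdeal β, eval x p = 0 := by
  obtain ⟨t, y, hy, rfl⟩ : ∃ (t : ℝ) (y : Fin n → ℝ),
      y ∈ convexHull ℝ (β : Set (Fin n → ℝ)) ∧ x = t • lift y := by
    rw [coe_coneFace, mem_hull_cone] at hx
    rcases hx with rfl | ⟨b, -, -, y, hy, rfl⟩
    · obtain ⟨v, hv⟩ := hβ
      exact ⟨0, v, subset_convexHull ℝ _ hv, by simp⟩
    · exact ⟨b, y, hy, rfl⟩
  have : homVanishingIdeal β ≤ RingHom.ker (eval (t • lift y) : PolyRing n →+* ℝ) := by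
    refine Ideal.span_le.2 ?_
    rintro _ ⟨p, hp, rfl⟩
    have h0 := mem_vanishingIdeal_iff.1 hp y hy
    rw [← RingHom.coe_coe, coe_aeval_eq_eval] at h0
    rw [SetLike.mem_coe, RingHom.mem_ker, eval_homogenization, h0, mul_zero]
  exact fun p hp => this hp

/-- Agreement of derivatives up to order `s` on the cone over a face in terms of the power of the
ideal of the face. -/
theorem mem_homVanishingIdeal_pow_iff {n : ℕ} {K : Complex n} {σ β : Finset (Fin n → ℝ)}
    (hσ : σ ∈ facesOfDim K n) (hβ : β ⊆ σ) (hne : β.Nonempty) (s : ℕ) (Q : PolyRing n) :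
    Q ∈ homVanishingIdeal β ^ (s + 1) ↔ ∀ L : List (Fin (n + 1)), L.length ≤ s →
      ∀ x ∈ convexHull ℝ (coneFace β : Set (Fin (n + 1) → ℝ)), eval x (iterPderiv L Q) = 0 := by
  classical
  refine ⟨fun hQ L hL x hx => eval_iterPderiv_eq_zero _ x
    (eval_eq_zero_of_mem_homVanishingIdeal hne hx) L s hL Q hQ, fun h => ?_⟩
  refine mem_pow_of_eval_iterPderiv hσ hβ _ (fun v _ hvβ => ?_) (δ := 1 / (n + 1)) (by positivity)
    s Q fun L hL c hc => h L hL _ ?_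
  · refine linForm_mem_homVanishingIdeal hne _ fun w hw => ?_
    rw [coneCoord_lift hσ v (hβ hw), if_neg]
    rintro rfl; exact hvβ hw
  · refine sum_mem_hull β c (fun v hv => (hc v hv).1.le) (sum_le_one_of_lt ?_ hc)
    exact (Finset.card_le_card hβ).trans hσ.2.le

/-! ### The chosen linear forms as multiples of vertex coordinates -/

theorem IsLinearFormOf.eq_C_mul {n : ℕ} {K : Complex n} {σ τ : Finset (Fin n → ℝ)}
    (hσ : σ ∈ facesOfDim K n) (hτ : τ ⊆ σ) (hc : τ.card = n) {v : Fin n → ℝ} (hv : v ∈ σ)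
    (hvτ : v ∉ τ) {ℓ : PolyRing n} (hℓ : IsLinearFormOf ℓ τ) :
    ∃ a : ℝ, a ≠ 0 ∧ ℓ = C a * linForm (coneCoord hσ v) := by
  obtain ⟨h0, h1, h2⟩ := hℓ
  obtain ⟨φ, rfl⟩ := exists_linForm_of_isHomogeneous h1
  have e : linForm φ = C (φ (lift v)) * linForm (coneCoord hσ v) := by
    refine MvPolynomial.funext fun x => ?_
    rw [map_mul, eval_C, eval_linForm, eval_linForm]
    refine eq_mul_coneCoord hσ hτ hc hv hvτ φ (fun w hw => ?_) x
    rw [← eval_linForm]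
    exact h2 _ (subset_convexHull ℝ _ (lift_mem_coneFace.2 hw))
  refine ⟨φ (lift v), fun h => h0 ?_, e⟩
  rw [e, h, C_0, zero_mul]

theorem IsLinearFormOf.pow_dvd_iff {n : ℕ} {K : Complex n} {σ τ : Finset (Fin n → ℝ)}
    (hσ : σ ∈ facesOfDim K n) (hτ : τ ⊆ σ) (hc : τ.card = n) {v : Fin n → ℝ} (hv : v ∈ σ)
    (hvτ : v ∉ τ) {ℓ : PolyRing n} (hℓ : IsLinearFormOf ℓ τ) (k : ℕ) (Q : PolyRing n) :
    ℓ ^ k ∣ Q ↔ linForm (coneCoord hσ v) ^ k ∣ Q := by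
  obtain ⟨a, ha, rfl⟩ := hℓ.eq_C_mul hσ hτ hc hv hvτ
  rw [mul_pow]
  have hu : IsUnit (C a ^ k : PolyRing n) := ((IsUnit.mk0 a ha).map C).pow k
  exact hu.mul_left_dvd

/-! ### Smoothness across a hyperplane -/

/-- If a function of class `C^k` vanishes to the left of the origin and equals `t ^ k * h t` to the
right of it, then `h` vanishes at the origin. -/
theorem eq_zero_of_contDiffOn {φ h : ℝ → ℝ} {k : ℕ} {δ : ℝ} (hδ : 0 < δ)
    (hφ : ContDiffOn ℝ k φ (Set.Ioo (-δ) δ)) (hl : ∀ t ∈ Set.Ioo (-δ) 0, φ t = 0)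
    (hr : ∀ t ∈ Set.Ioo 0 δ, φ t = t ^ k * h t) (hh : ContinuousAt h 0) : h 0 = 0 := by
  have h0 : (0 : ℝ) ∈ Set.Ioo (-δ) δ := ⟨by linarith, hδ⟩
  have hU : UniqueDiffOn ℝ (Set.Ioo (-δ) δ) := isOpen_Ioo.uniqueDiffOn
  -- The derivatives are continuous and vanish to the left of the origin.
  have hder : ∀ j ≤ k, iteratedDerivWithin j φ (Set.Ioo (-δ) δ) 0 = 0 := by
    intro j hj
    have hcont := hφ.continuousOn_iteratedDerivWithin (m := j) (by exact_mod_cast hj) hU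
    have h1 : Filter.Tendsto (iteratedDerivWithin j φ (Set.Ioo (-δ) δ))
        (nhdsWithin 0 (Set.Iio 0)) (nhds (iteratedDerivWithin j φ (Set.Ioo (-δ) δ) 0)) :=
      ((hcont 0 h0).continuousAt (isOpen_Ioo.mem_nhds h0)).tendsto.mono_left nhdsWithin_le_nhds
    refine tendsto_nhds_unique h1 ((tendsto_const_nhds (x := (0 : ℝ))).congr' ?_)
    filter_upwards [Ioo_mem_nhdsLT (show -δ < 0 by linarith)] with t ht
    have ht' : t ∈ Set.Ioo (-δ) δ := ⟨ht.1, ht.2.trans hδ⟩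
    have e : φ =ᶠ[nhds t] fun _ => 0 := by
      filter_upwards [isOpen_Ioo.mem_nhds ht] with u hu using hl u hu
    rw [iteratedDerivWithin_of_isOpen isOpen_Ioo ht', e.iteratedDeriv_eq j]
    simp
  -- Since the Taylor polynomial of order `k` at the origin vanishes, `φ t / t ^ k`, which is `h t`
  -- on the right, tends to zero.
  have ht := taylor_tendsto (convex_Ioo (-δ) δ) h0 hφ
  have hT : ∀ x, taylorWithinEval φ k (Set.Ioo (-δ) δ) 0 x = 0 := by
    intro x
    rw [taylor_within_apply]
    refine Finset.sum_eq_zero fun j hj => ?_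
    rw [hder j (by rw [Finset.mem_range] at hj; omega), smul_zero]
  have h2 : Filter.Tendsto h (nhdsWithin 0 (Set.Ioi 0)) (nhds 0) := by
    refine (ht.mono_left ?_).congr' ?_
    · rw [nhdsWithin_eq_nhds.2 (isOpen_Ioo.mem_nhds h0)]; exact nhdsWithin_le_nhds
    · filter_upwards [Ioo_mem_nhdsGT hδ] with t ht
      rw [hT, hr t ht]
      have : t ≠ 0 := ht.1.ne'
      simp [this]
  exact tendsto_nhds_unique (hh.tendsto.mono_left nhdsWithin_le_nhds) h2

/-! ### Truncated powers -/

theorem hasDerivAt_max_pow (m : ℕ) (t : ℝ) :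
    HasDerivAt (fun t : ℝ => max t 0 ^ (m + 2)) ((m + 2 : ℕ) * max t 0 ^ (m + 1)) t := by
  rcases lt_trichotomy t 0 with h | rfl | h
  · have e : (fun t : ℝ => max t 0 ^ (m + 2)) =ᶠ[nhds t] fun _ => 0 := by
      filter_upwards [isOpen_Iio.mem_nhds h] with u hu
      rw [max_eq_right (le_of_lt hu)]; simp
    rw [max_eq_right h.le]
    simpa using (hasDerivAt_const t (0 : ℝ)).congr_of_eventuallyEq e
  · rw [← hasDerivWithinAt_univ, ← Set.Iic_union_Ici (a := (0 : ℝ))]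
    refine HasDerivWithinAt.union ?_ ?_
    · have := (hasDerivWithinAt_const (0 : ℝ) (Set.Iic 0) (0 : ℝ)).congr
        (f₁ := fun t : ℝ => max t 0 ^ (m + 2))
        (fun u hu => by rw [max_eq_right hu]; simp) (by simp)
      simpa using this
    · have := ((hasDerivAt_pow (m + 2) (0 : ℝ)).hasDerivWithinAt (s := Set.Ici 0)).congr
        (f₁ := fun t : ℝ => max t 0 ^ (m + 2))
        (fun u hu => by rw [max_eq_left hu]) (by simp)
      simpa using this
  · have e : (fun t : ℝ => max t 0 ^ (m + 2)) =ᶠ[nhds t] fun t => t ^ (m + 2) := by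
      filter_upwards [isOpen_Ioi.mem_nhds h] with u hu
      rw [max_eq_left (le_of_lt hu)]
    rw [max_eq_left h.le]
    exact (hasDerivAt_pow (m + 2) t).congr_of_eventuallyEq e

theorem contDiff_max_pow (m : ℕ) : ContDiff ℝ m fun t : ℝ => max t 0 ^ (m + 1) := by
  induction m with
  | zero =>
    rw [Nat.cast_zero, contDiff_zero]
    fun_prop
  | succ m ih =>
    rw [Nat.cast_succ, contDiff_succ_iff_deriv]
    refine ⟨fun t => (hasDerivAt_max_pow m t).differentiableAt, by simp, ?_⟩
    have e : deriv (fun t : ℝ => max t 0 ^ (m + 1 + 1)) =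
        fun t => ((m + 2 : ℕ) : ℝ) * max t 0 ^ (m + 1) :=
      funext fun t => (hasDerivAt_max_pow m t).deriv
    rw [e]
    exact contDiff_const.mul ih

section

variable {n : ℕ} {K : Complex n} {σ σ' τ : Finset (Fin n → ℝ)}

/-- Let `λ` be the coordinate of `v`. If `P - P' = λ ^ k * H` with `k ≤ r`, restrict `f - P'` to a
line in direction `v` through a point with small positive coefficients on `τ`. It is zero on one
side and `t ^ k * H` on the other, so `C^k` smoothness makes `H` vanish at that point. Hence `H`
vanishes on the span of the cone over `τ`, `λ` divides `H`, and the exponent can be raised. -/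
theorem linForm_pow_dvd_of_contDiffOn (hσ : σ ∈ facesOfDim K n) (hσ' : σ' ∈ facesOfDim K n)
    (hne : σ ≠ σ') (hτ : τ ⊆ σ) (hτ' : τ ⊆ σ') (hc : τ.card = n) {v : Fin n → ℝ} (hv : v ∈ σ)
    (hvτ : v ∉ τ) {r : ℕ} {f : (Fin (n + 1) → ℝ) → ℝ} {S : Set (Fin (n + 1) → ℝ)}
    (hS : convexHull ℝ (coneFace σ : Set (Fin (n + 1) → ℝ)) ⊆ S)
    (hS' : convexHull ℝ (coneFace σ' : Set (Fin (n + 1) → ℝ)) ⊆ S)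
    (hf : ContDiffOn ℝ r f S) {P P' : PolyRing n}
    (hP : ∀ x ∈ convexHull ℝ (coneFace σ : Set (Fin (n + 1) → ℝ)), f x = eval x P)
    (hP' : ∀ x ∈ convexHull ℝ (coneFace σ' : Set (Fin (n + 1) → ℝ)), f x = eval x P') :
    linForm (coneCoord hσ v) ^ (r + 1) ∣ P - P' := by
  classical
  suffices H : ∀ k ≤ r + 1, linForm (coneCoord hσ v) ^ k ∣ P - P' from H _ le_rfl
  intro k
  induction k with
  | zero => simp
  | succ k ih =>
    intro hk
    obtain ⟨H, hH⟩ := ih (by omega)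
    obtain ⟨v', hv', hvτ'⟩ := exists_mem_notMem_of_facet hσ' hc
    have hneg := coneCoord_neg hσ' hσ hne.symm hτ' hτ hc hv' hvτ' hv hvτ
    have hi := insert_eq_of_card hτ hv hvτ (by rw [hσ.2, hc])
    have hi' := insert_eq_of_card hτ' hv' hvτ' (by rw [hσ'.2, hc])
    -- Divisibility by the linear form is the order-zero case of the Taylor criterion.
    suffices hd : H ∈ Ideal.span {linForm (coneCoord hσ v)} ^ (0 + 1) by
      rw [zero_add, pow_one, Ideal.mem_span_singleton] at hd
      rw [hH, pow_succ]
      exact mul_dvd_mul_left _ hd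
    refine mem_pow_of_eval_iterPderiv hσ hτ _ (fun w hw hwτ => ?_) (δ := 1 / (n + 1))
      (by positivity) 0 H fun L hL c hcc => ?_
    · rw [← hi, Finset.mem_insert] at hw
      obtain rfl : w = v := hw.resolve_right hwτ
      exact Ideal.subset_span rfl
    obtain rfl : L = [] := List.eq_nil_of_length_eq_zero (by omega)
    change eval _ H = 0
    set x₀ := ∑ w ∈ τ, c w • lift w with hx₀
    have hx₀0 : x₀ 0 < 1 := by
      rw [hx₀, sum_smul_lift_zero]
      have h1 := Finset.sum_le_card_nsmul τ c (1 / (n + 1)) fun v hv => (hcc v hv).2.le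
      refine h1.trans_lt ?_
      rw [hc, nsmul_eq_mul, mul_one_div, div_lt_one (by positivity)]
      linarith
    -- For small `t` the line stays below height one and keeps positive `σ'`-coordinates at the
    -- vertices of `τ`; the sign of the remaining coordinate decides which of the two cones contains
    -- the point.
    have hev : ∀ᶠ t : ℝ in nhds 0, (∀ w ∈ τ, 0 < c w + t * coneCoord hσ' w (lift v)) ∧
        x₀ 0 + t < 1 := by
      refine Filter.Eventually.and ?_ ?_
      · rw [Filter.eventually_all_finset]
        intro w hw
        refine ContinuousAt.eventually_lt continuousAt_const (by fun_prop) ?_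
        simpa using (hcc w hw).1
      · refine ContinuousAt.eventually_lt (by fun_prop) continuousAt_const ?_
        simpa using hx₀0
    obtain ⟨δ, hδ, hball⟩ := Metric.eventually_nhds_iff.1 hev
    have hab : ∀ t ∈ Set.Ioo (-δ) δ, (∀ w ∈ τ, 0 < c w + t * coneCoord hσ' w (lift v)) ∧
        x₀ 0 + t < 1 := fun t ht => hball (by
      rw [Real.dist_eq, sub_zero, abs_lt]; exact ht)
    set γ : ℝ → Fin (n + 1) → ℝ := fun t => x₀ + t • lift v with hγ
    have hγ0 : ∀ t, γ t 0 = x₀ 0 + t := fun t => by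
      simp only [hγ, Pi.add_apply, smul_lift_zero]
    have hlam : ∀ t, coneCoord hσ v (γ t) = t := fun t => by
      simp only [hγ, map_add, map_smul]
      rw [hx₀, coneCoord_sum hσ hτ, if_neg hvτ, coneCoord_lift hσ v hv]
      simp
    have hpos : ∀ t ∈ Set.Ioo (-δ) δ, 0 ≤ t →
        γ t ∈ convexHull ℝ (coneFace σ : Set (Fin (n + 1) → ℝ)) := by
      intro t ht h0
      refine mem_hull_of_coneCoord hσ (fun w hw => ?_) (by rw [hγ0]; exact (hab t ht).2.le)
      rw [← hi, Finset.mem_insert] at hw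
      rcases hw with rfl | hw
      · rwa [hlam]
      · simp only [hγ, map_add, map_smul]
        rw [hx₀, coneCoord_sum hσ hτ, if_pos hw, coneCoord_lift hσ w hv, if_neg]
        · simpa using (hcc w hw).1.le
        · rintro rfl; exact hvτ hw
    have hnonpos : ∀ t ∈ Set.Ioo (-δ) δ, t ≤ 0 →
        γ t ∈ convexHull ℝ (coneFace σ' : Set (Fin (n + 1) → ℝ)) := by
      intro t ht h0
      refine mem_hull_of_coneCoord hσ' (fun w hw => ?_) (by rw [hγ0]; exact (hab t ht).2.le)
      simp only [hγ, map_add, map_smul]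
      rw [hx₀, coneCoord_sum hσ' hτ', smul_eq_mul]
      rw [← hi', Finset.mem_insert] at hw
      rcases hw with rfl | hw
      · rw [if_neg hvτ', zero_add]
        exact mul_nonneg_of_nonpos_of_nonpos h0 hneg.le
      · rw [if_pos hw]
        exact ((hab t ht).1 w hw).le
    have hγd : ContDiff ℝ k γ := by
      simp only [hγ]
      exact contDiff_const.add (contDiff_id.smul contDiff_const)
    have hφ : ContDiffOn ℝ k (fun t => f (γ t) - eval (γ t) P') (Set.Ioo (-δ) δ) := by
      refine ContDiffOn.sub ?_ ((contDiff_eval P' k).comp hγd).contDiffOn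
      refine (hf.of_le ?_).comp hγd.contDiffOn fun t ht => ?_
      · exact_mod_cast (by omega : k ≤ r)
      · rcases le_total 0 t with h0 | h0
        · exact hS (hpos t ht h0)
        · exact hS' (hnonpos t ht h0)
    have := eq_zero_of_contDiffOn (h := fun t => eval (γ t) H) hδ hφ
      (fun t ht => by
        rw [hP' _ (hnonpos t ⟨ht.1, ht.2.trans hδ⟩ ht.2.le), sub_self])
      (fun t ht => by
        rw [hP _ (hpos t ⟨by linarith [ht.1], ht.2⟩ ht.1.le), ← map_sub, hH, map_mul, map_pow,
          eval_linForm, hlam])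
      ((contDiff_eval H 0).continuous.comp (hγd.continuous)).continuousAt
    simpa [hγ] using this

/-- On the two cones `f` coincides with `P' + max(λ, 0) ^ (r + 1) * H`, a function of class `C^r` on
the whole space, because `λ` is nonnegative on the cone over `σ` and nonpositive on the cone over
`σ'`. -/
theorem contDiffOn_of_linForm_pow_dvd (hσ : σ ∈ facesOfDim K n) (hσ' : σ' ∈ facesOfDim K n)
    (hne : σ ≠ σ') (hτ : τ ⊆ σ) (hτ' : τ ⊆ σ') (hc : τ.card = n) {v : Fin n → ℝ} (hv : v ∈ σ)
    (hvτ : v ∉ τ) {r : ℕ} {f : (Fin (n + 1) → ℝ) → ℝ} {S : Set (Fin (n + 1) → ℝ)}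
    (hS : S ⊆ convexHull ℝ (coneFace σ : Set (Fin (n + 1) → ℝ)) ∪
      convexHull ℝ (coneFace σ' : Set (Fin (n + 1) → ℝ))) {P P' : PolyRing n}
    (hP : ∀ x ∈ convexHull ℝ (coneFace σ : Set (Fin (n + 1) → ℝ)), f x = eval x P)
    (hP' : ∀ x ∈ convexHull ℝ (coneFace σ' : Set (Fin (n + 1) → ℝ)), f x = eval x P')
    (hd : linForm (coneCoord hσ v) ^ (r + 1) ∣ P - P') : ContDiffOn ℝ r f S := by
  obtain ⟨H, hH⟩ := hd
  obtain ⟨v', hv', hvτ'⟩ := exists_mem_notMem_of_facet hσ' hc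
  have hneg := coneCoord_neg hσ hσ' hne hτ hτ' hc hv hvτ hv' hvτ'
  have hlin : ContDiff ℝ r fun x => coneCoord hσ v x := by
    simpa only [eval_linForm] using contDiff_eval (linForm (coneCoord hσ v)) r
  have hg : ContDiff ℝ r fun x => eval x P' + max (coneCoord hσ v x) 0 ^ (r + 1) * eval x H :=
    (contDiff_eval P' r).add (((contDiff_max_pow r).comp hlin).mul (contDiff_eval H r))
  refine hg.contDiffOn.congr fun x hx => ?_
  rcases hS hx with h | h
  · rw [hP x h, max_eq_left (coneCoord_nonneg hσ v h), ← eval_linForm, ← map_pow, ← map_mul,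
      ← map_add, ← hH, add_sub_cancel]
  · rw [hP' x h, max_eq_right]
    · simp
    · rw [eq_mul_coneCoord hσ' hτ' hc hv' hvτ' (coneCoord hσ v) (fun w hw => by
        rw [coneCoord_lift hσ v (hτ hw), if_neg]; rintro rfl; exact hvτ hw) x]
      exact mul_nonpos_of_nonpos_of_nonneg hneg.le (coneCoord_nonneg hσ' v' h)

theorem hull_subset_starSpace (hσ : σ ∈ K.faces) (hτ : τ ⊆ σ) :
    convexHull ℝ (coneFace σ : Set (Fin (n + 1) → ℝ)) ⊆ starSpace (cone K) (coneFace τ) := by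
  intro x hx
  simp only [starSpace, Set.mem_iUnion]
  exact ⟨coneFace σ, ⟨σ, Or.inl ⟨hσ, Or.inl rfl⟩⟩, coneFace_subset.2 hτ, hx⟩

/-- A face of the cone containing `coneFace τ` contains the apex, so it is the cone over `τ` or over
an `n`-face on `τ`, and there are only two of the latter. -/
theorem starSpace_coneFace_subset (hn : 1 ≤ n) (hσ : σ ∈ facesOfDim K n)
    (hσ' : σ' ∈ facesOfDim K n) (hne : σ ≠ σ') (hτ : τ ⊆ σ) (hτ' : τ ⊆ σ') (hc : τ.card = n) :
    starSpace (cone K) (coneFace τ) ⊆ convexHull ℝ (coneFace σ : Set (Fin (n + 1) → ℝ)) ∪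
      convexHull ℝ (coneFace σ' : Set (Fin (n + 1) → ℝ)) := by
  intro x hx
  simp only [starSpace, Set.mem_iUnion] at hx
  obtain ⟨t, ⟨ρ, ⟨hρ, rfl | rfl⟩ | ⟨rfl, rfl⟩⟩, hs, hx⟩ := hx
  · have hs' := coneFace_subset.1 hs
    have hle := Finset.card_le_card hs'
    have hle' := card_le_of_mem_faces hρ
    by_cases hcρ : ρ.card = n
    · obtain rfl := Finset.eq_of_subset_of_card_le hs' (by omega)
      exact Or.inl (convexHull_mono (Finset.coe_subset.2 (coneFace_subset.2 hτ)) hx)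
    · have hρn : ρ ∈ facesOfDim K n := ⟨hρ, by omega⟩
      by_cases h : σ = ρ
      · exact Or.inl (h ▸ hx)
      · exact Or.inr ((eq_of_three_faces hσ hσ' hρn hτ hτ' hs' hc hne h) ▸ hx)
  · exact absurd (hs (mem_coneFace.2 (Or.inl rfl))) (zero_notMem_lift ρ)
  · have := Finset.card_le_card (coneFace_subset.1 hs)
    rw [Finset.card_empty] at this
    omega

end

/-! ### Orientations of the `n`-faces -/

theorem exists_orderEmbOfFin_erase {α : Type*} [LinearOrder α] (s : Finset α) {k : ℕ}
    (hs : s.card = k + 1) {v : α} (hv : v ∈ s) (he : (s.erase v).card = k) :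
    ∃ p : Fin (k + 1), (p : ℕ) = (s.filter (· < v)).card ∧ s.orderEmbOfFin hs p = v ∧
      ∀ j, s.orderEmbOfFin hs (p.succAbove j) = (s.erase v).orderEmbOfFin he j := by
  have hp : v ∈ Set.range (s.orderEmbOfFin hs) := by rw [Finset.range_orderEmbOfFin]; exact hv
  obtain ⟨p, hp⟩ := hp
  refine ⟨p, ?_, hp, fun j => ?_⟩
  · have e : s.filter (· < v) = (Finset.Iio p).map (s.orderEmbOfFin hs).toEmbedding := by
      ext w
      simp only [Finset.mem_filter, Finset.mem_map, Finset.mem_Iio, RelEmbedding.coe_toEmbedding]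
      constructor
      · rintro ⟨hw, hwv⟩
        have hw' : w ∈ Set.range (s.orderEmbOfFin hs) := by
          rw [Finset.range_orderEmbOfFin]; exact hw
        obtain ⟨q, rfl⟩ := hw'
        rw [← hp, OrderEmbedding.lt_iff_lt] at hwv
        exact ⟨q, hwv, rfl⟩
      · rintro ⟨q, hq, rfl⟩
        exact ⟨Finset.orderEmbOfFin_mem s hs q, by rwa [← hp, OrderEmbedding.lt_iff_lt]⟩
    rw [e, Finset.card_map, Fin.card_Iio]
  · have := Finset.orderEmbOfFin_unique he
      (f := fun j => s.orderEmbOfFin hs (p.succAbove j)) (fun j => ?_)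
      ((s.orderEmbOfFin hs).strictMono.comp (Fin.strictMono_succAbove p))
    · exact congrFun this j
    · refine Finset.mem_erase.2 ⟨?_, Finset.orderEmbOfFin_mem s hs _⟩
      rw [← hp]
      exact fun h => Fin.succAbove_ne p j ((s.orderEmbOfFin hs).injective h)

/-- Moving the row with index `p` to the front changes the determinant by the sign `(-1) ^ p`. -/
theorem det_eq_neg_one_pow_mul_det_cons {n : ℕ} (g : Fin (n + 1) → Fin (n + 1) → ℝ)
    (p : Fin (n + 1)) :
    Matrix.detRowAlternating g = (-1) ^ (p : ℕ) *
      Matrix.detRowAlternating (Fin.cons (g p) fun j => g (p.succAbove j) :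
        Fin (n + 1) → Fin (n + 1) → ℝ) := by
  have h : (Fin.cons (g p) fun j => g (p.succAbove j) : Fin (n + 1) → Fin (n + 1) → ℝ) ∘
      p.cycleRange = g := by
    rw [Fin.cons_comp_cycleRange]
    exact Fin.insertNth_self_removeNth p g
  conv_lhs => rw [← h]
  rw [AlternatingMap.map_perm, Fin.sign_cycleRange]
  simp [Units.smul_def]

/-- The determinant is linear in its first row, and vanishes when that row repeats another. -/
theorem exists_functional_det {n : ℕ} (w : Fin n → Fin (n + 1) → ℝ) :
    ∃ φ : (Fin (n + 1) → ℝ) →ₗ[ℝ] ℝ,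
      (∀ x, φ x = Matrix.detRowAlternating (Fin.cons x w : Fin (n + 1) → Fin (n + 1) → ℝ)) ∧
      ∀ j, φ (w j) = 0 := by
  have h : ∀ x, Matrix.detRowAlternating.toMultilinearMap.toLinearMap
      (Fin.cons 0 w : Fin (n + 1) → Fin (n + 1) → ℝ) 0 x =
      Matrix.detRowAlternating (Fin.cons x w : Fin (n + 1) → Fin (n + 1) → ℝ) := fun x => by
    simp [MultilinearMap.toLinearMap_apply]
  refine ⟨_, h, fun j => ?_⟩
  rw [h]
  exact AlternatingMap.map_eq_zero_of_eq _ _ (i := 0) (j := j.succ) (by simp)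
    (Fin.succ_ne_zero j).symm

open Classical in
-- `D σ` is the determinant of the ordered vertices, and `φ x` the determinant of `x` followed by
-- the ordered vertices of `τ`; moving `v` to the front costs the incidence sign. The vertex type is
-- abstract because `Fin n → ℝ` already carries its pointwise partial order, which is not the order
-- `lt`.
theorem exists_det_functional {α : Type*} [LinearOrder α] (lt : α → α → Prop)
    (hlt : ∀ a b, lt a b ↔ a < b) {n : ℕ} (f : α → Fin (n + 1) → ℝ) :
    ∃ D : Finset α → ℝ,
      (∀ σ : Finset α, σ.card = n + 1 → LinearIndependent ℝ (fun x : σ => f x.1) → D σ ≠ 0) ∧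
      ∀ τ : Finset α, τ.card = n → ∃ φ : (Fin (n + 1) → ℝ) →ₗ[ℝ] ℝ, (∀ w ∈ τ, φ (f w) = 0) ∧
        ∀ σ : Finset α, σ.card = n + 1 → τ ⊆ σ → ∀ v ∈ σ, v ∉ τ →
          D σ = (-1) ^ (σ.filter fun w => lt w v).card * φ (f v) := by
  refine ⟨fun σ => if h : σ.card = n + 1 then
    Matrix.detRowAlternating (fun k => f (σ.orderEmbOfFin h k)) else 0, fun σ hσ hli => ?_,
    fun τ hc => ?_⟩
  · simp only
    rw [dif_pos hσ]
    have hli' : LinearIndependent ℝ fun k => f (σ.orderEmbOfFin hσ k) :=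
      hli.comp (σ.orderIsoOfFin hσ) (σ.orderIsoOfFin hσ).injective
    have hu' := (Matrix.linearIndependent_rows_iff_isUnit
      (A := Matrix.of fun k => f (σ.orderEmbOfFin hσ k))).1 hli'
    exact ((Matrix.isUnit_iff_isUnit_det _).1 hu').ne_zero
  · obtain ⟨φ, hφ, hφ0⟩ := exists_functional_det fun j => f (τ.orderEmbOfFin hc j)
    refine ⟨φ, fun w hw => ?_, fun σ hσ hτ v hv hvτ => ?_⟩
    · have hw' : w ∈ Set.range (τ.orderEmbOfFin hc) := by
        rw [Finset.range_orderEmbOfFin]; exact hw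
      obtain ⟨q, rfl⟩ := hw'
      exact hφ0 q
    · obtain rfl : σ.erase v = τ := by
        rw [← insert_eq_of_card hτ hv hvτ (by rw [hσ, hc]), Finset.erase_insert hvτ]
      obtain ⟨p, hp, hpu, hpj⟩ := exists_orderEmbOfFin_erase σ hσ hv hc
      simp only
      rw [dif_pos hσ, det_eq_neg_one_pow_mul_det_cons _ p, hφ, hpu, hp]
      simp only [hpj, hlt]

open Classical in
/-- Signs of the `n`-faces for which the orientations induced on a common codimension one face are
opposite. -/
theorem exists_orientation {n : ℕ} (K : Complex n) (lt : (Fin n → ℝ) → (Fin n → ℝ) → Prop)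
    [IsStrictTotalOrder (Fin n → ℝ) lt] :
    ∃ ε : Finset (Fin n → ℝ) → ℤˣ, ∀ σ ∈ facesOfDim K n, ∀ σ' ∈ facesOfDim K n, σ ≠ σ' →
      ∀ τ : Finset (Fin n → ℝ), τ ⊆ σ → τ ⊆ σ' → τ.card = n →
        ∀ v ∈ σ, v ∉ τ → ∀ v' ∈ σ', v' ∉ τ →
        (ε σ : ℤ) * (-1) ^ (σ.filter fun w => lt w v).card =
          -((ε σ' : ℤ) * (-1) ^ (σ'.filter fun w => lt w v').card) := by
  obtain ⟨D, hD0, hD⟩ := @exists_det_functional _ (linearOrderOfSTO lt) lt (fun _ _ => Iff.rfl) n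
    lift
  -- With `ε σ` the sign of `D σ`, the product of `ε σ` and the incidence sign of `v` is the sign of
  -- `φ (lift v)`. Since `φ` is a multiple of the coordinate of `v`, which is negative at `v'`, the
  -- signs at `v` and `v'` are opposite.
  refine ⟨fun σ => if 0 < D σ then 1 else -1, ?_⟩
  rintro σ hσ σ' hσ' hne τ hτ hτ' hc v hv hvτ v' hv' hvτ'
  obtain ⟨φ, hφτ, hφ⟩ := hD τ hc
  have h1 := hφ σ hσ.2 hτ v hv hvτ
  have h2 := hφ σ' hσ'.2 hτ' v' hv' hvτ'
  have h1' := hD0 σ hσ.2 (linearIndependent_lift (K.indep hσ.1))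
  have h2' := hD0 σ' hσ'.2 (linearIndependent_lift (K.indep hσ'.1))
  have h4 := coneCoord_neg hσ hσ' hne hτ hτ' hc hv hvτ hv' hvτ'
  rw [eq_mul_coneCoord hσ hτ hc hv hvτ φ hφτ (lift v')] at h2
  generalize coneCoord hσ v (lift v') = a at h2 h4
  generalize φ (lift v) = b at h1 h2
  have hb : 0 < b ^ 2 := by
    have : b ≠ 0 := by rintro rfl; exact h1' (by rw [h1, mul_zero])
    positivity
  have hs : ∀ m : ℕ, ((-1 : ℝ) ^ m = 1 ∧ (-1 : ℤ) ^ m = 1) ∨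
      ((-1 : ℝ) ^ m = -1 ∧ (-1 : ℤ) ^ m = -1) := by
    intro m
    rcases Nat.even_or_odd m with h | h <;> simp [h.neg_one_pow]
  have hab : a * b ^ 2 < 0 := mul_neg_of_neg_of_pos h4 hb
  rcases hs (σ.filter fun w => lt w v).card with ⟨e, e2⟩ | ⟨e, e2⟩ <;>
  rcases hs (σ'.filter fun w => lt w v').card with ⟨e', e2'⟩ | ⟨e', e2'⟩ <;>
  rw [e] at h1 <;> rw [e'] at h2 <;> simp only [e2, e2'] <;> split_ifs with g1 g2 g2 <;>
  first
    | (simp; done)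
    | (exfalso; nlinarith)

/-! ### Superspline pieces and the facet ideals -/

/-- The pieces `P` on two `n`-faces that share an interior codimension one face differ by an element
of the ideal of that face. -/
def IsCompatible {n : ℕ} (K : Complex n) (i : ℕ) (r s : Finset (Fin n → ℝ) → ℕ)
    (ℓ : Finset (Fin n → ℝ) → PolyRing n) (P : Finset (Fin n → ℝ) → PolyRing n) : Prop :=
  ∀ τ ∈ interiorFaces K (n - 1), ∀ σ ∈ facesOfDim K n, ∀ σ' ∈ facesOfDim K n, τ ⊆ σ → τ ⊆ σ' →
    P σ - P σ' ∈ facetIdeal K i r s ℓ τ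

/-- The function `f` on the cone over `K` is given by `P σ` on the cone over each `n`-face `σ`. -/
def IsPiecewise {n : ℕ} (K : Complex n) (P : Finset (Fin n → ℝ) → PolyRing n)
    (f : FunOn (cone K).space) : Prop :=
  ∀ σ ∈ facesOfDim K n, ∀ x : (cone K).space,
    x.1 ∈ convexHull ℝ (coneFace σ : Set (Fin (n + 1) → ℝ)) → f x = eval x.1 (P σ)

section

variable {n i : ℕ} {K : Complex n} {r s : Finset (Fin n → ℝ) → ℕ}
  {ℓ : Finset (Fin n → ℝ) → PolyRing n} {P : Finset (Fin n → ℝ) → PolyRing n}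

theorem mem_facetIdeal_iff {τ : Finset (Fin n → ℝ)} {Q : PolyRing n} :
    Q ∈ facetIdeal K i r s ℓ τ ↔ ℓ τ ^ (r τ + 1) ∣ Q ∧
      ∀ β ∈ facesOfDim K i, β ⊆ τ → Q ∈ homVanishingIdeal β ^ (s β + 1) := by
  simp [facetIdeal, Submodule.mem_iInf, Ideal.mem_span_singleton]

theorem mem_cone_space {σ : Finset (Fin n → ℝ)} (hσ : σ ∈ K.faces) {x : Fin (n + 1) → ℝ}
    (hx : x ∈ convexHull ℝ (coneFace σ : Set (Fin (n + 1) → ℝ))) : x ∈ (cone K).space :=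
  Geometry.SimplicialComplex.convexHull_subset_space (K := cone K)
    ⟨σ, Or.inl ⟨hσ, Or.inl rfl⟩⟩ hx

theorem IsPiecewise.extendZero_eq {f : FunOn (cone K).space} (hf : IsPiecewise K P f)
    {σ : Finset (Fin n → ℝ)} (hσ : σ ∈ facesOfDim K n) {x : Fin (n + 1) → ℝ}
    (hx : x ∈ convexHull ℝ (coneFace σ : Set (Fin (n + 1) → ℝ))) :
    extendZero f x = eval x (P σ) :=
  (extendZero_apply f ⟨x, mem_cone_space hσ.1 hx⟩).trans (hf σ hσ ⟨x, _⟩ hx)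

theorem IsPiecewise.unique {f : FunOn (cone K).space} (hf : IsPiecewise K P f)
    {P' : Finset (Fin n → ℝ) → PolyRing n} (hf' : IsPiecewise K P' f)
    {σ : Finset (Fin n → ℝ)} (hσ : σ ∈ facesOfDim K n) : P σ = P' σ :=
  eq_of_eval_eq_on_coneFace hσ fun _ hx =>
    (hf.extendZero_eq hσ hx).symm.trans (hf'.extendZero_eq hσ hx)

theorem exists_isPiecewise_of_mem (hn : 1 ≤ n)
    (hℓ : ∀ τ ∈ interiorFaces K (n - 1), IsLinearFormOf (ℓ τ) τ) {f : FunOn (cone K).space}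
    (hf : f ∈ coneSuperspline K i r s) :
    ∃ P, IsPiecewise K P f ∧ IsCompatible K i r s ℓ P := by
  obtain ⟨d, P', hP', -, hr, hs⟩ := hf
  have hcone : ∀ σ ∈ facesOfDim K n, coneFace σ ∈ facesOfDim (cone K) (n + 1) := fun σ hσ => by
    rw [facesOfDim_cone]; exact ⟨σ, hσ, rfl⟩
  have hpw : IsPiecewise K (fun σ => P' (coneFace σ)) f := fun σ hσ =>
    (hP' _ (hcone σ hσ)).2
  refine ⟨_, hpw, fun τ hτ σ hσ σ' hσ' hs1 hs2 => ?_⟩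
  by_cases hne : σ = σ'
  · rw [hne, sub_self]; exact Ideal.zero_mem _
  have hc : τ.card = n := by have := hτ.1.2; omega
  obtain ⟨v, hv, hvτ⟩ := exists_mem_notMem_of_facet hσ hc
  rw [mem_facetIdeal_iff]
  constructor
  · rw [(hℓ τ hτ).pow_dvd_iff hσ hs1 hc hv hvτ]
    have h := hr (coneFace τ) (by
      rw [Nat.add_sub_cancel, interiorFaces_cone hn]; exact ⟨τ, hτ, rfl⟩)
    simp only [baseFace_coneFace] at h
    exact linForm_pow_dvd_of_contDiffOn hσ hσ' hne hs1 hs2 hc hv hvτ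
      (hull_subset_starSpace hσ.1 hs1) (hull_subset_starSpace hσ'.1 hs2) h
      (fun x hx => hpw.extendZero_eq hσ hx) (fun x hx => hpw.extendZero_eq hσ' hx)
  · intro β hβ hβτ
    have h := hs (coneFace β) ⟨β, hβ, rfl⟩
    simp only [baseFace_coneFace] at h
    rw [mem_homVanishingIdeal_pow_iff hσ (hβτ.trans hs1) (K.nonempty_of_mem_faces hβ.1)]
    intro L hL x hx
    rw [iterPderiv_sub, map_sub, sub_eq_zero]
    exact h _ (hcone σ hσ) _ (hcone σ' hσ') (coneFace_subset.2 (hβτ.trans hs1))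
      (coneFace_subset.2 (hβτ.trans hs2)) L hL x hx

/-- The differences telescope along the chain provided by heredity, each step crossing an interior
`(n-1)`-face that contains `β`. The ideal `A` is left free: the kernel of an evaluation yields
agreement of values, a power of the ideal of a face yields supersmoothness. -/
theorem IsCompatible.sub_mem (hP : IsCompatible K i r s ℓ P) (hher : IsHereditary K)
    {σ σ' β : Finset (Fin n → ℝ)} (hσ : σ ∈ facesOfDim K n) (hσ' : σ' ∈ facesOfDim K n)
    (hβ : β ∈ K.faces) (hi : (β : Set (Fin n → ℝ)) = (σ : Set (Fin n → ℝ)) ∩ σ')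
    (A : Ideal (PolyRing n))
    (hA : ∀ τ ∈ interiorFaces K (n - 1), β ⊆ τ → facetIdeal K i r s ℓ τ ≤ A) :
    P σ - P σ' ∈ A := by
  obtain ⟨m, c, rfl, rfl, hc, hτ⟩ := hher σ hσ σ' hσ' β hβ hi
  suffices H : ∀ k ≤ m, P (c 0) - P (c k) ∈ A from H m le_rfl
  intro k
  induction k with
  | zero => simp
  | succ k ih =>
    intro hk
    obtain ⟨τ, hτ, e⟩ := hτ k (by omega)
    have h1 : τ ⊆ c k := Finset.coe_subset.1 (e ▸ Set.inter_subset_left)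
    have h2 : τ ⊆ c (k + 1) := Finset.coe_subset.1 (e ▸ Set.inter_subset_right)
    have h3 : β ⊆ τ := Finset.coe_subset.1
      (e ▸ Set.subset_inter (Finset.coe_subset.2 (hc k (by omega)).2)
        (Finset.coe_subset.2 (hc (k + 1) hk).2))
    have h4 := hA τ hτ h3 (hP τ hτ _ (hc k (by omega)).1 _ (hc (k + 1) hk).1 h1 h2)
    have := Ideal.add_mem _ (ih (by omega)) h4
    rwa [sub_add_sub_cancel] at this

theorem facetIdeal_le_ker_eval {τ : Finset (Fin n → ℝ)} (hℓ : IsLinearFormOf (ℓ τ) τ)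
    {x : Fin (n + 1) → ℝ} (hx : x ∈ convexHull ℝ (coneFace τ : Set (Fin (n + 1) → ℝ))) :
    facetIdeal K i r s ℓ τ ≤ RingHom.ker (eval x : PolyRing n →+* ℝ) := by
  intro Q hQ
  obtain ⟨H, rfl⟩ := (mem_facetIdeal_iff.1 hQ).1
  rw [RingHom.mem_ker, map_mul, map_pow, hℓ.2.2 x hx, zero_pow (Nat.succ_ne_zero _), zero_mul]

theorem zero_mem_hull_coneFace (τ : Finset (Fin n → ℝ)) :
    (0 : Fin (n + 1) → ℝ) ∈ convexHull ℝ (coneFace τ : Set (Fin (n + 1) → ℝ)) :=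
  subset_convexHull ℝ _ (mem_coneFace.2 (Or.inl rfl))

open Classical in
theorem inter_mem_faces {σ σ' : Finset (Fin n → ℝ)} (hσ : σ ∈ K.faces)
    (h : (σ ∩ σ').Nonempty) : σ ∩ σ' ∈ K.faces :=
  K.down_closed hσ Finset.inter_subset_left h

/-- By connectedness of the underlying space, compatible pieces agree at the apex of the cone. -/
theorem IsCompatible.eval_zero_eq (hP : IsCompatible K i r s ℓ P) (hfin : K.faces.Finite)
    (hconn : IsConnected K.space) (hpure : IsPure K) (hher : IsHereditary K)
    (hℓ : ∀ τ ∈ interiorFaces K (n - 1), IsLinearFormOf (ℓ τ) τ)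
    {σ σ' : Finset (Fin n → ℝ)} (hσ : σ ∈ facesOfDim K n) (hσ' : σ' ∈ facesOfDim K n) :
    eval 0 (P σ) = eval 0 (P σ') := by
  classical
  have hmeet : ∀ ρ ∈ facesOfDim K n, ∀ ρ' ∈ facesOfDim K n, ∀ y,
      y ∈ convexHull ℝ (ρ : Set (Fin n → ℝ)) → y ∈ convexHull ℝ (ρ' : Set (Fin n → ℝ)) →
      eval 0 (P ρ) = eval 0 (P ρ') := by
    intro ρ hρ ρ' hρ' y hy hy'
    have hyy := K.inter_subset_convexHull hρ.1 hρ'.1 ⟨hy, hy'⟩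
    rw [← Finset.coe_inter] at hyy
    have hne : (ρ ∩ ρ').Nonempty := by
      rw [Finset.nonempty_iff_ne_empty]; intro h0; rw [h0] at hyy; simp at hyy
    have := hP.sub_mem hher hρ hρ' (inter_mem_faces hρ.1 hne) (Finset.coe_inter _ _)
      (RingHom.ker (eval 0 : PolyRing n →+* ℝ)) fun τ hτ _ =>
        facetIdeal_le_ker_eval (hℓ τ hτ) (zero_mem_hull_coneFace τ)
    rwa [RingHom.mem_ker, map_sub, sub_eq_zero] at this
  have hF : (facesOfDim K n).Finite := hfin.subset fun _ h => h.1
  have hclosed : ∀ p : Finset (Fin n → ℝ) → Prop,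
      IsClosed (⋃ ρ ∈ {ρ | ρ ∈ facesOfDim K n ∧ p ρ}, convexHull ℝ (ρ : Set (Fin n → ℝ))) :=
    fun p => (hF.subset fun _ h => h.1).isClosed_biUnion fun ρ _ =>
      (ρ.finite_toSet.isClosed_convexHull ℝ)
  have hpoint : ∀ ρ ∈ facesOfDim K n, ∃ y ∈ K.space, y ∈ convexHull ℝ (ρ : Set (Fin n → ℝ)) := by
    intro ρ hρ
    obtain ⟨v, hv⟩ := K.nonempty_of_mem_faces hρ.1
    have := subset_convexHull ℝ (ρ : Set (Fin n → ℝ)) hv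
    exact ⟨v, Geometry.SimplicialComplex.convexHull_subset_space hρ.1 this, this⟩
  by_contra hne
  -- Sort the `n`-faces by whether their piece agrees with `P σ` at the apex. The two unions are
  -- closed and cover `|Δ|`; if both were nonempty they would meet, and `n`-faces that meet have
  -- pieces with equal values at the apex.
  have h := isPreconnected_closed_iff.1 hconn.isPreconnected _ _
    (hclosed fun ρ => eval 0 (P ρ) = eval 0 (P σ)) (hclosed fun ρ => eval 0 (P ρ) ≠ eval 0 (P σ))
    (fun y hy => ?_) ?_ ?_
  · obtain ⟨y, -, hy, hy'⟩ := h
    simp only [Set.mem_iUnion, Set.mem_ofPred_eq] at hy hy'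
    obtain ⟨ρ, ⟨hρ, h1⟩, hy⟩ := hy
    obtain ⟨ρ', ⟨hρ', h2⟩, hy'⟩ := hy'
    exact h2 ((hmeet ρ hρ ρ' hρ' y hy hy').symm.trans h1)
  · obtain ⟨t, ht, hyt⟩ := Geometry.SimplicialComplex.mem_space_iff.1 hy
    obtain ⟨ρ, hρ, htρ⟩ := exists_facet_of_face hfin hpure ht
    have hyρ := convexHull_mono (Finset.coe_subset.2 htρ) hyt
    simp only [Set.mem_union, Set.mem_iUnion, Set.mem_ofPred_eq]
    by_cases h1 : eval 0 (P ρ) = eval 0 (P σ)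
    · exact Or.inl ⟨ρ, ⟨hρ, h1⟩, hyρ⟩
    · exact Or.inr ⟨ρ, ⟨hρ, h1⟩, hyρ⟩
  · obtain ⟨y, hy, hyσ⟩ := hpoint σ hσ
    refine ⟨y, hy, ?_⟩
    simp only [Set.mem_iUnion, Set.mem_ofPred_eq]
    exact ⟨σ, ⟨hσ, rfl⟩, hyσ⟩
  · obtain ⟨y, hy, hyσ⟩ := hpoint σ' hσ'
    refine ⟨y, hy, ?_⟩
    simp only [Set.mem_iUnion, Set.mem_ofPred_eq]
    exact ⟨σ', ⟨hσ', fun h => hne h.symm⟩, hyσ⟩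

theorem IsCompatible.eval_eq (hP : IsCompatible K i r s ℓ P) (hfin : K.faces.Finite)
    (hconn : IsConnected K.space) (hpure : IsPure K) (hher : IsHereditary K)
    (hℓ : ∀ τ ∈ interiorFaces K (n - 1), IsLinearFormOf (ℓ τ) τ)
    {σ σ' : Finset (Fin n → ℝ)} (hσ : σ ∈ facesOfDim K n) (hσ' : σ' ∈ facesOfDim K n)
    {x : Fin (n + 1) → ℝ} (hx : x ∈ convexHull ℝ (coneFace σ : Set (Fin (n + 1) → ℝ)))
    (hx' : x ∈ convexHull ℝ (coneFace σ' : Set (Fin (n + 1) → ℝ))) :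
    eval x (P σ) = eval x (P σ') := by
  classical
  by_cases h0 : x = 0
  · subst h0; exact hP.eval_zero_eq hfin hconn hpure hher hℓ hσ hσ'
  -- Away from the apex this forces `σ ∩ σ'` to be a nonempty face, so heredity applies to it.
  have hxx : x ∈ convexHull ℝ (coneFace (σ ∩ σ') : Set (Fin (n + 1) → ℝ)) := by
    refine convexHull_mono ?_ (mem_hull_inter_coneFace K hσ.1 hσ'.1 hx hx')
    rintro z ⟨hz, hz'⟩
    rcases mem_coneFace.1 hz with rfl | ⟨w, hw, rfl⟩
    · exact mem_coneFace.2 (Or.inl rfl)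
    · exact lift_mem_coneFace.2 (Finset.mem_inter.2 ⟨hw, lift_mem_coneFace.1 hz'⟩)
  have hne : (σ ∩ σ').Nonempty := by
    rw [Finset.nonempty_iff_ne_empty]; intro he; rw [he] at hxx
    simp [coe_coneFace, h0] at hxx
  have := hP.sub_mem hher hσ hσ' (inter_mem_faces hσ.1 hne) (Finset.coe_inter _ _)
    (RingHom.ker (eval x : PolyRing n →+* ℝ)) fun τ hτ hs =>
      facetIdeal_le_ker_eval (hℓ τ hτ)
        (convexHull_mono (Finset.coe_subset.2 (coneFace_subset.2 hs)) hxx)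
  rwa [RingHom.mem_ker, map_sub, sub_eq_zero] at this

/-! ### Assembling a spline from compatible pieces -/

theorem exists_mem_hull_of_mem_cone_space (hfin : K.faces.Finite) (hne : K.space.Nonempty)
    (hpure : IsPure K) {x : Fin (n + 1) → ℝ} (hx : x ∈ (cone K).space) :
    ∃ σ ∈ facesOfDim K n, x ∈ convexHull ℝ (coneFace σ : Set (Fin (n + 1) → ℝ)) := by
  have key : ∀ ρ ∈ K.faces, ∀ t ⊆ coneFace ρ, x ∈ convexHull ℝ (t : Set (Fin (n + 1) → ℝ)) →
      ∃ σ ∈ facesOfDim K n, x ∈ convexHull ℝ (coneFace σ : Set (Fin (n + 1) → ℝ)) := by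
    intro ρ hρ t ht hxt
    obtain ⟨σ, hσ, hs⟩ := exists_facet_of_face hfin hpure hρ
    exact ⟨σ, hσ, convexHull_mono (Finset.coe_subset.2 (ht.trans (coneFace_subset.2 hs))) hxt⟩
  obtain ⟨t, ⟨ρ, ⟨hρ, rfl | rfl⟩ | ⟨rfl, rfl⟩⟩, hxt⟩ :=
    Geometry.SimplicialComplex.mem_space_iff.1 hx
  · exact key ρ hρ _ subset_rfl hxt
  · exact key ρ hρ _ (Finset.subset_cons _) hxt
  -- The apex is a face of the cone even over an empty complex; nonemptiness supplies an `n`-face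
  -- whose cone contains it.
  · obtain ⟨y, hy⟩ := hne
    obtain ⟨ρ, hρ, -⟩ := Geometry.SimplicialComplex.mem_space_iff.1 hy
    exact key ρ hρ _ (coneFace_subset.2 (Finset.empty_subset ρ)) hxt

/-- Compatible pieces are the pieces of a superspline. -/
theorem IsCompatible.exists_mem (hP : IsCompatible K i r s ℓ P) (hn : 1 ≤ n)
    (hfin : K.faces.Finite) (hconn : IsConnected K.space) (hpure : IsPure K)
    (hher : IsHereditary K) (hℓ : ∀ τ ∈ interiorFaces K (n - 1), IsLinearFormOf (ℓ τ) τ) :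
    ∃ f ∈ coneSuperspline K i r s, IsPiecewise K P f := by
  classical
  choose ν hν hxν using fun x : (cone K).space =>
    exists_mem_hull_of_mem_cone_space hfin hconn.nonempty hpure x.2
  have hF : (facesOfDim K n).Finite := hfin.subset fun _ h => h.1
  obtain ⟨f, hf⟩ : ∃ f : FunOn (cone K).space, IsPiecewise K P f :=
    -- The value does not depend on the `n`-face `ν x` chosen for `x`, since compatible pieces agree
    -- on overlaps.
    ⟨fun x => eval x.1 (P (ν x)), fun σ hσ x hx =>
      hP.eval_eq hfin hconn hpure hher hℓ (hν x) hσ (hxν x) hx⟩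
  refine ⟨f, ⟨hF.toFinset.sup fun σ => (P σ).totalDegree, fun t => P (baseFace t), ?_, ?_, ?_, ?_⟩,
    hf⟩
  · rw [HasPieces, facesOfDim_cone]
    rintro _ ⟨σ, hσ, rfl⟩
    rw [baseFace_coneFace]
    exact ⟨Finset.le_sup (f := fun σ => (P σ).totalDegree) (hF.mem_toFinset.2 hσ), hf σ hσ⟩
  · have : Finite (facesOfDim K n) := hF
    have hcover : (cone K).space ⊆ ⋃ σ : facesOfDim K n,
        convexHull ℝ (coneFace σ.1 : Set (Fin (n + 1) → ℝ)) := fun x hx => by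
      obtain ⟨σ, hσ, hxσ⟩ := exists_mem_hull_of_mem_cone_space hfin hconn.nonempty hpure hx
      exact Set.mem_iUnion.2 ⟨⟨σ, hσ⟩, hxσ⟩
    have hclosed : ∀ σ : facesOfDim K n,
        IsClosed (convexHull ℝ (coneFace σ.1 : Set (Fin (n + 1) → ℝ))) := fun σ =>
      (coneFace σ.1).finite_toSet.isClosed_convexHull ℝ
    refine ContinuousOn.mono (LocallyFinite.continuousOn_iUnion (f := fun σ : facesOfDim K n =>
      convexHull ℝ (coneFace σ.1 : Set (Fin (n + 1) → ℝ))) (locallyFinite_of_finite _)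
      hclosed fun σ => ?_) hcover
    exact (contDiff_eval (P σ.1) 0).continuous.continuousOn.congr fun x hx =>
      hf.extendZero_eq σ.2 hx
  · rw [Nat.add_sub_cancel, interiorFaces_cone hn]
    rintro _ ⟨τ, hτ, rfl⟩
    simp only [baseFace_coneFace]
    have hc : τ.card = n := by have := hτ.1.2; omega
    obtain ⟨σ, hσ, σ', hσ', hs1, hs2, hne⟩ := exists_two_faces hn hfin hpure hτ
    obtain ⟨v, hv, hvτ⟩ := exists_mem_notMem_of_facet hσ hc
    refine contDiffOn_of_linForm_pow_dvd hσ hσ' hne hs1 hs2 hc hv hvτ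
      (starSpace_coneFace_subset hn hσ hσ' hne hs1 hs2 hc)
      (fun x hx => hf.extendZero_eq hσ hx) (fun x hx => hf.extendZero_eq hσ' hx) ?_
    rw [← (hℓ τ hτ).pow_dvd_iff hσ hs1 hc hv hvτ]
    exact (mem_facetIdeal_iff.1 (hP τ hτ σ hσ σ' hσ' hs1 hs2)).1
  · rintro _ ⟨β, hβ, rfl⟩
    simp only [baseFace_coneFace]
    rw [SmoothAtFace, facesOfDim_cone]
    rintro _ ⟨σ, hσ, rfl⟩ _ ⟨σ', hσ', rfl⟩ hs1 hs2
    rw [coneFace_subset] at hs1 hs2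
    rw [baseFace_coneFace, baseFace_coneFace]
    have hβne := K.nonempty_of_mem_faces hβ.1
    have hβi : β ⊆ σ ∩ σ' := Finset.subset_inter hs1 hs2
    -- Heredity is applied to `σ ∩ σ'`, which may be larger than `β`; every `(n-1)`-face crossed
    -- still contains `β`, so its ideal lies in the required power.
    have h := hP.sub_mem hher hσ hσ' (inter_mem_faces hσ.1 (hβne.mono hβi))
      (Finset.coe_inter _ _) (homVanishingIdeal β ^ (s β + 1)) fun τ hτ hs Q hQ =>
        (mem_facetIdeal_iff.1 hQ).2 β hβ (hβi.trans hs)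
    rw [mem_homVanishingIdeal_pow_iff hσ hs1 hβne] at h
    intro L hL x hx
    have h2 := h L hL x hx
    rwa [iterPderiv_sub, map_sub, sub_eq_zero] at h2

end

/-! ### The top differential -/

theorem interiorFaces_top {n : ℕ} (K : Complex n) : interiorFaces K n = facesOfDim K n := by
  refine Set.Subset.antisymm (fun _ h => h.1) fun σ hσ => ⟨hσ, ?_⟩
  rintro ⟨τ, -, hc, hs, -⟩
  have := Finset.card_le_card hs
  have := hσ.2
  omega

theorem idealChains_top {n : ℕ} (hn : 1 ≤ n) (K : Complex n) (i : ℕ)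
    (r s : Finset (Fin n → ℝ) → ℕ) (ℓ : Finset (Fin n → ℝ) → PolyRing n) :
    idealChains K i r s ℓ n = ⊥ := by
  rw [eq_bot_iff]
  intro c hc
  rw [Submodule.mem_bot]
  ext1 σ
  have := hc σ
  rw [faceIdeal_top hn K i r s ℓ σ.2.1] at this
  exact this

/-- No third `n`-face contains `τ`, so only `σ` and `σ'` contribute to this coefficient. -/
theorem boundaryMap_apply {n : ℕ} (hn : 1 ≤ n) (lt : (Fin n → ℝ) → (Fin n → ℝ) → Prop)
    (K : Complex n) (c : chains K n) (τ : interiorFaces K (n - 1)) {σ σ' : interiorFaces K n}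
    (hne : σ ≠ σ') (hτ : τ.1 ⊆ σ.1) (hτ' : τ.1 ⊆ σ'.1) {v v' : Fin n → ℝ} (hv : v ∈ σ.1)
    (hvτ : v ∉ τ.1) (hv' : v' ∈ σ'.1) (hvτ' : v' ∉ τ.1) :
    boundaryMap lt K n (n - 1) c τ =
      c σ * incidenceSign lt σ.1 v + c σ' * incidenceSign lt σ'.1 v' := by
  classical
  have hc : τ.1.card = n := by have := τ.2.1.2; omega
  have hsym : ∀ γ : Finset (Fin n → ℝ), symbol K (n - 1) γ τ = if γ = τ.1 then 1 else 0 := by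
    intro γ
    by_cases h : γ ∈ interiorFaces K (n - 1)
    · rw [symbol, dif_pos h, Finsupp.single_apply]; simp only [Subtype.ext_iff]
    · rw [symbol, dif_neg h, if_neg (by rintro rfl; exact h τ.2), Finsupp.zero_apply]
  have hone : ∀ (ρ : interiorFaces K n) (u : Fin n → ℝ), τ.1 ⊆ ρ.1 → u ∈ ρ.1 → u ∉ τ.1 →
      (∑ w ∈ ρ.1, incidenceSign lt ρ.1 w • symbol K (n - 1) (ρ.1.erase w)) τ =
        incidenceSign lt ρ.1 u := by
    intro ρ u hs hu huτ
    have hins := insert_eq_of_card hs hu huτ (by rw [ρ.2.1.2, hc])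
    rw [Finsupp.finsetSum_apply, Finset.sum_eq_single u]
    · rw [Finsupp.smul_apply, hsym, if_pos, smul_eq_mul, mul_one]
      rw [← hins, Finset.erase_insert huτ]
    · intro w hw hwu
      rw [Finsupp.smul_apply, hsym, if_neg, smul_zero]
      intro h
      exact huτ (h ▸ Finset.mem_erase.2 ⟨hwu.symm, hu⟩)
    · exact fun h => absurd hu h
  have hzero : ∀ ρ : interiorFaces K n, ρ ≠ σ → ρ ≠ σ' →
      (∑ w ∈ ρ.1, incidenceSign lt ρ.1 w • symbol K (n - 1) (ρ.1.erase w)) τ = 0 := by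
    intro ρ h1 h2
    rw [Finsupp.finsetSum_apply]
    refine Finset.sum_eq_zero fun w _ => ?_
    rw [Finsupp.smul_apply, hsym, if_neg, smul_zero]
    intro h
    have hs : τ.1 ⊆ ρ.1 := h ▸ Finset.erase_subset _ _
    exact h2 (Subtype.ext (eq_of_three_faces σ.2.1 σ'.2.1 ρ.2.1 hτ hτ' hs hc
      (fun e => hne (Subtype.ext e)) (fun e => h1 (Subtype.ext e.symm)))).symm
  -- The sum is first enlarged by `{σ, σ'}`, as these faces need not lie in the support of `c`, and
  -- then cut down to this pair.
  rw [boundaryMap, Finsupp.linearCombination_apply, Finsupp.sum, Finsupp.finsetSum_apply,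
    Finset.sum_subset (Finset.subset_union_left (s₂ := {σ, σ'})),
    ← Finset.sum_subset (Finset.subset_union_right (s₁ := c.support)), Finset.sum_pair hne]
  · rw [Finsupp.smul_apply, Finsupp.smul_apply, hone σ v hτ hv hvτ, hone σ' v' hτ' hv' hvτ',
      smul_eq_mul, smul_eq_mul]
  · intro ρ _ h
    rw [Finset.mem_insert, Finset.mem_singleton, not_or] at h
    rw [Finsupp.smul_apply, hzero ρ h.1 h.2, smul_zero]
  · intro ρ _ h
    rw [Finsupp.notMem_support_iff.1 h, zero_smul, Finsupp.zero_apply]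

/-- A chain of `n`-faces has its boundary in the ideal chains if and only if its coefficients,
corrected by the orientation signs, are compatible. -/
theorem exists_boundaryMap_mem_iff {n : ℕ} (hn : 1 ≤ n) {K : Complex n} (hfin : K.faces.Finite)
    (hpure : IsPure K) (i : ℕ) (r s : Finset (Fin n → ℝ) → ℕ)
    (ℓ : Finset (Fin n → ℝ) → PolyRing n) (lt : (Fin n → ℝ) → (Fin n → ℝ) → Prop)
    [IsStrictTotalOrder (Fin n → ℝ) lt] :
    ∃ ε : Finset (Fin n → ℝ) → ℤˣ, ∀ (P : Finset (Fin n → ℝ) → PolyRing n) (c : chains K n),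
      (∀ σ, c σ = ((ε σ.1 : ℤ) : PolyRing n) * P σ.1) →
      (boundaryMap lt K n (n - 1) c ∈ idealChains K i r s ℓ (n - 1) ↔
        IsCompatible K i r s ℓ P) := by
  classical
  obtain ⟨ε, hε⟩ := exists_orientation K lt
  refine ⟨ε, fun P c hc => ?_⟩
  have key : ∀ τ : interiorFaces K (n - 1), ∀ σ ∈ facesOfDim K n, ∀ σ' ∈ facesOfDim K n,
      τ.1 ⊆ σ → τ.1 ⊆ σ' → σ ≠ σ' →
      (boundaryMap lt K n (n - 1) c τ ∈ faceIdeal K i r s ℓ τ.1 ↔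
        P σ - P σ' ∈ facetIdeal K i r s ℓ τ.1) := by
    intro τ σ hσ σ' hσ' hs1 hs2 hne
    have hcτ : τ.1.card = n := by have := τ.2.1.2; omega
    obtain ⟨v, hv, hvτ⟩ := exists_mem_notMem_of_facet hσ hcτ
    obtain ⟨v', hv', hvτ'⟩ := exists_mem_notMem_of_facet hσ' hcτ
    rw [faceIdeal_facet K i r s ℓ τ.2, boundaryMap_apply hn lt K c τ
      (σ := ⟨σ, interiorFaces_top K ▸ hσ⟩) (σ' := ⟨σ', interiorFaces_top K ▸ hσ'⟩)
      (fun e => hne (congrArg Subtype.val e)) hs1 hs2 hv hvτ hv' hvτ', hc, hc]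
    have h := congrArg (Int.cast : ℤ → PolyRing n)
      (hε σ hσ σ' hσ' hne τ.1 hs1 hs2 hcτ v hv hvτ v' hv' hvτ')
    push_cast at h
    -- The opposite induced orientations turn the boundary coefficient into a unit times `P σ - P
    -- σ'`.
    have e : ((ε σ : ℤ) : PolyRing n) * P σ * incidenceSign lt σ v +
        ((ε σ' : ℤ) : PolyRing n) * P σ' * incidenceSign lt σ' v' =
        (((ε σ : ℤ) : PolyRing n) * incidenceSign lt σ v) * (P σ - P σ') := by
      have h' : ((ε σ' : ℤ) : PolyRing n) * incidenceSign lt σ' v' =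
          -(((ε σ : ℤ) : PolyRing n) * incidenceSign lt σ v) := by
        simp only [incidenceSign]
        rw [h, neg_neg]
      linear_combination P σ' * h'
    have hu : IsUnit (((ε σ : ℤ) : PolyRing n) * incidenceSign lt σ v) := by
      refine IsUnit.mul ?_ ((isUnit_one.neg).pow _)
      exact (ε σ).isUnit.map (Int.castRingHom (PolyRing n))
    rw [e]
    exact Ideal.unit_mul_mem_iff_mem _ hu
  constructor
  · intro h τ hτ σ hσ σ' hσ' hs1 hs2
    by_cases hne : σ = σ'
    · rw [hne, sub_self]; exact Ideal.zero_mem _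
    · exact (key ⟨τ, hτ⟩ σ hσ σ' hσ' hs1 hs2 hne).1 (h ⟨τ, hτ⟩)
  · intro h τ
    obtain ⟨σ, hσ, σ', hσ', hs1, hs2, hne⟩ := exists_two_faces hn hfin hpure τ.2
    exact (key τ σ hσ σ' hσ' hs1 hs2 hne).2 (h τ.1 τ.2 σ hσ σ' hσ' hs1 hs2)

/-! ### The isomorphism with the kernel of the top differential -/

theorem mem_ker_quotientBoundary_iff {n i : ℕ} {K : Complex n} {r s : Finset (Fin n → ℝ) → ℕ}
    {ℓ : Finset (Fin n → ℝ) → PolyRing n} {lt : (Fin n → ℝ) → (Fin n → ℝ) → Prop} {j k : ℕ}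
    (c : chains K j) :
    (idealChains K i r s ℓ j).mkQ c ∈ LinearMap.ker (quotientBoundary lt K i r s ℓ j k) ↔
      boundaryMap lt K j k c ∈ idealChains K i r s ℓ k := by
  rw [LinearMap.mem_ker, quotientBoundary, Submodule.mkQ_apply, Submodule.mapQ_apply,
    Submodule.Quotient.mk_eq_zero]

/-- The kernel consists of classes modulo `𝒥ₙ`, so the formula is stated for a representative `c`,
which is unique because `𝒥ₙ = 0`. The sign may stand on either side since it squares to one. -/
theorem exists_equiv_ker_quotientBoundary {n i : ℕ} (hn : 1 ≤ n) {K : Complex n}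
    (hfin : K.faces.Finite) (hconn : IsConnected K.space) (hpure : IsPure K)
    (hher : IsHereditary K) (r s : Finset (Fin n → ℝ) → ℕ)
    (ℓ : Finset (Fin n → ℝ) → PolyRing n)
    (hℓ : ∀ τ ∈ interiorFaces K (n - 1), IsLinearFormOf (ℓ τ) τ)
    (lt : (Fin n → ℝ) → (Fin n → ℝ) → Prop) [IsStrictTotalOrder (Fin n → ℝ) lt] :
    ∃ (e : coneSuperspline K i r s ≃ₗ[PolyRing n]
          LinearMap.ker (quotientBoundary lt K i r s ℓ n (n - 1)))
      (ε : interiorFaces K n → ℤˣ),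
      ∀ (f : coneSuperspline K i r s) (c : chains K n),
        (idealChains K i r s ℓ n).mkQ c = (e f).1 →
        ∀ (σ : interiorFaces K n) (x : (cone K).space),
          x.1 ∈ convexHull ℝ (coneFace σ.1 : Set (Fin (n + 1) → ℝ)) →
          f.1 x = ((ε σ : ℤ) : ℝ) * MvPolynomial.eval x.1 (c σ) := by
  classical
  obtain ⟨ε, hε⟩ := exists_boundaryMap_mem_iff hn hfin hpure i r s ℓ lt
  have hεε : ∀ σ, ((ε σ : ℤ) : PolyRing n) * ((ε σ : ℤ) : PolyRing n) = 1 := fun σ => by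
    rw [← Int.cast_mul, ← Units.val_mul, Int.units_mul_self]; simp
  choose P hP hPc using fun f : coneSuperspline K i r s => exists_isPiecewise_of_mem hn hℓ f.2
  have : Finite (interiorFaces K n) := hfin.subset fun _ h => h.1.1
  have hmkQ : Function.Injective (idealChains K i r s ℓ n).mkQ := by
    rw [← LinearMap.ker_eq_bot, Submodule.ker_mkQ, idealChains_top hn]
  -- The pieces were obtained by choice; `Φ` is linear because they are unique on each `n`-face.
  let Φ : coneSuperspline K i r s →ₗ[PolyRing n] chains K n :=
    { toFun := fun f => Finsupp.equivFunOnFinite.symm fun σ => ((ε σ.1 : ℤ) : PolyRing n) * P f σ.1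
      map_add' := fun f g => by
        ext1 σ
        have h : P (f + g) σ.1 = P f σ.1 + P g σ.1 :=
          (hP (f + g)).unique (P' := fun σ => P f σ + P g σ) (fun σ hσ x hx => by
            rw [map_add, ← hP f σ hσ x hx, ← hP g σ hσ x hx]; rfl) σ.2.1
        simp [h, mul_add]
      map_smul' := fun p f => by
        ext1 σ
        have h : P (p • f) σ.1 = p * P f σ.1 :=
          (hP (p • f)).unique (P' := fun σ => p * P f σ) (fun σ hσ x hx => by
            rw [map_mul, ← hP f σ hσ x hx]; rfl) σ.2.1
        simp [h]; ring }
  have hΦ : ∀ f σ, Φ f σ = ((ε σ.1 : ℤ) : PolyRing n) * P f σ.1 := fun f σ => rfl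
  have hker : ∀ f, (idealChains K i r s ℓ n).mkQ (Φ f) ∈
      LinearMap.ker (quotientBoundary lt K i r s ℓ n (n - 1)) := fun f => by
    rw [mem_ker_quotientBoundary_iff, hε (P f) (Φ f) (hΦ f)]
    exact hPc f
  let Ψ := LinearMap.codRestrict (LinearMap.ker (quotientBoundary lt K i r s ℓ n (n - 1)))
    ((idealChains K i r s ℓ n).mkQ ∘ₗ Φ) hker
  have hΨ : ∀ f, (Ψ f).1 = (idealChains K i r s ℓ n).mkQ (Φ f) := fun f => rfl
  have hbij : Function.Bijective Ψ := by
    constructor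
    · intro f g hfg
      have h1 : Φ f = Φ g := hmkQ (congrArg Subtype.val hfg)
      refine Subtype.ext (funext fun x => ?_)
      obtain ⟨σ, hσ, hx⟩ := exists_mem_hull_of_mem_cone_space hfin hconn.nonempty hpure x.2
      have h2 := DFunLike.congr_fun h1 (⟨σ, interiorFaces_top K ▸ hσ⟩ : interiorFaces K n)
      rw [hΦ, hΦ] at h2
      have h3 : P f σ = P g σ := by
        have := congrArg (fun q => ((ε σ : ℤ) : PolyRing n) * q) h2
        simpa only [← mul_assoc, hεε, one_mul] using this
      exact (hP f σ hσ x hx).trans (h3 ▸ (hP g σ hσ x hx).symm)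
    · rintro ⟨q, hq⟩
      obtain ⟨c, rfl⟩ := Submodule.mkQ_surjective _ q
      set Q : Finset (Fin n → ℝ) → PolyRing n := fun σ =>
        if h : σ ∈ interiorFaces K n then ((ε σ : ℤ) : PolyRing n) * c ⟨σ, h⟩ else 0 with hQ
      have hQc : ∀ σ : interiorFaces K n, c σ = ((ε σ.1 : ℤ) : PolyRing n) * Q σ.1 := fun σ => by
        rw [hQ]; simp only
        rw [dif_pos σ.2, ← mul_assoc, hεε, one_mul]
      rw [mem_ker_quotientBoundary_iff, hε Q c hQc] at hq
      obtain ⟨f, hf, hfQ⟩ := hq.exists_mem hn hfin hconn hpure hher hℓ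
      refine ⟨⟨f, hf⟩, Subtype.ext ?_⟩
      rw [hΨ]
      congr 1
      ext1 σ
      rw [hΦ, hQc, (hP ⟨f, hf⟩).unique hfQ σ.2.1]
  refine ⟨LinearEquiv.ofBijective Ψ hbij, fun σ => ε σ.1, fun f c hc σ x hx => ?_⟩
  have h1 : c = Φ f := hmkQ hc
  have h2 : ((ε σ.1 : ℤ) : PolyRing n) * c σ = P f σ.1 := by
    rw [h1, hΦ, ← mul_assoc, hεε, one_mul]
  rw [hP f σ.1 σ.2.1 x hx, ← h2, map_mul, map_intCast]

end SuperSpline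

open SuperSpline in
theorem corollary3p4 {n i : ℕ} (hi : i + 2 ≤ n) (Δ : Complex n) (hfin : Δ.faces.Finite)
    (hconn : IsConnected Δ.space) (hpure : IsPure Δ) (hher : IsHereditary Δ)
    (r s : Finset (Fin n → ℝ) → ℕ)
    (hrs : ∀ τ ∈ interiorFaces Δ (n - 1), ∀ β ∈ interiorFaces Δ i, r τ ≤ s β)
    (ℓ : Finset (Fin n → ℝ) → MvPolynomial (Fin (n + 1)) ℝ)
    (hℓ : ∀ τ ∈ interiorFaces Δ (n - 1), IsLinearFormOf (ℓ τ) τ)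
    (lt : (Fin n → ℝ) → (Fin n → ℝ) → Prop) [IsStrictTotalOrder (Fin n → ℝ) lt] :
    ∃ (e : coneSuperspline Δ i r s ≃ₗ[MvPolynomial (Fin (n + 1)) ℝ]
          LinearMap.ker ((quotientComplex lt Δ i r s ℓ).d n (n - 1)).hom)
      (ε : interiorFaces Δ n → ℤˣ),
      ∀ (f : coneSuperspline Δ i r s) (c : chains Δ n),
        (idealChains Δ i r s ℓ n).mkQ c = (e f).1 →
        ∀ (σ : interiorFaces Δ n) (x : (cone Δ).space),
          x.1 ∈ convexHull ℝ (coneFace σ.1 : Set (Fin (n + 1) → ℝ)) →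
          f.1 x = ((ε σ : ℤ) : ℝ) * MvPolynomial.eval x.1 (c σ) :=
  -- The differential of `quotientComplex` is `quotientBoundary` by definition.
  exists_equiv_ker_quotientBoundary (by omega) hfin hconn hpure hher r s ℓ hℓ lt
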